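/- For positive integers $n$ and $d$, let the Hamming torus of dimension $d$ be the graph on $[n]^d=\{1,\dots,n\}^d$ in which two vertices are adjacent iff they differ in exactly one coordinate. In bootstrap percolation with threshold $\theta\in\mathbb{N}$ each vertex is initially open independently with probability $p$; at each time step every vertex with at least $\theta$ open neighbors becomes open, and open vertices stay open forever. For $1\le i\le d$, an $i$-dimensional subgraph is the set of vertices obtained by fixing $d-i$ of the coordinates and letting the other $i$ coordinates vary over $[n]$. Let $p_c(i,d)=p_c(i,d;n,\theta)$ be the value of $p\in[0,1]$ for which the probability that all vertices of some $i$-dimensional subgraph are eventually open equals $1/2$. **Theorem.** For all $d\ge 3$ and $2\le i\le d$ there are constants $c,C>0$ (depending only on $i$ and $d$) and $\theta_0$ such that for every $\theta\ge\theta_0$ and all sufficiently large $n$ (depending on $i$, $d$, $\theta$), the threshold $p_c(i,d)$ exists and is unique, and $$n^{-1-\frac{2}{\theta}-\frac{C}{\theta^{3/2}}}\;\le\; p_c(i,d)\;\le\; n^{-1-\frac{2}{\theta}-\frac{c}{\theta^{3/2}}}.$$ In short, $p_c(i,d)=n^{-1-2/\theta-\Theta(\theta^{-3/2})}$. -/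

import Mathlib

namespace HammingBootstrap

/-- The Hamming torus with vertex set `[n]^d`: two vertices are adjacent iff they differ in
exactly one coordinate. -/
def hammingTorus (n d : ℕ) : SimpleGraph (Fin d → Fin n) where
  Adj v w := hammingDist v w = 1
  symm := ⟨fun v w h => by rw [hammingDist_comm]; exact h⟩
  loopless := ⟨fun v h => by simp at h⟩

/-- One step of bootstrap percolation with threshold `θ` on the graph `G`. A configuration is given
by its set `A` of open vertices; a vertex is open after the step iff it was open before or has at
least `θ` open neighbours. -/
def bootstrapStep {V : Type*} (G : SimpleGraph V) (θ : ℕ) (A : Set V) : Set V :=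
  {v | v ∈ A ∨ (θ : ℕ∞) ≤ (G.neighborSet v ∩ A).encard}

/-- The set of vertices open at time `j`, started from the set `A` of initially open vertices. -/
def openAt {V : Type*} (G : SimpleGraph V) (θ : ℕ) (A : Set V) (j : ℕ) : Set V :=
  (bootstrapStep G θ)^[j] A

/-- The set of vertices that are eventually open. As the sets `openAt G θ A j` increase with `j`,
this is the limit configuration of the process. -/
def finalOpen {V : Type*} (G : SimpleGraph V) (θ : ℕ) (A : Set V) : Set V :=
  ⋃ j : ℕ, openAt G θ A j

/-- `F` is the vertex set of an `i`-dimensional subgraph of the Hamming torus `[n]^d`: the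
coordinates in some set `S` of size `i` are free, and all the others are fixed. -/
def IsSubtorus {n d : ℕ} (i : ℕ) (F : Set (Fin d → Fin n)) : Prop :=
  ∃ (S : Finset (Fin d)) (a : Fin d → Fin n), S.card = i ∧ F = {v | ∀ j, j ∉ S → v j = a j}

/-- The event (as a set of initial configurations) that some `i`-dimensional subgraph is
eventually open. -/
def someSubtorusOpen (n d i θ : ℕ) : Set (Set (Fin d → Fin n)) :=
  {A | ∃ F, IsSubtorus i F ∧ F ⊆ finalOpen (hammingTorus n d) θ A}

/-- The probability that some `i`-dimensional subgraph is eventually open, when every vertex of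
`[n]^d` is initially open with probability `p`, independently of the others. -/
noncomputable def probSubtorusOpen (n d i θ : ℕ) (p : unitInterval) : ℝ :=
  (ProbabilityTheory.setBernoulli (Set.univ : Set (Fin d → Fin n)) p).real
    (someSubtorusOpen n d i θ)

/-- `p` is the threshold (critical probability) for some `i`-dimensional subgraph of `[n]^d` to
become open: at `p` this has probability exactly `1/2`. -/
def IsThreshold (n d i θ : ℕ) (p : unitInterval) : Prop :=
  probSubtorusOpen n d i θ p = 1 / 2

end HammingBootstrap

/-!
Put `p = n ^ (-1 - b)`, so that a line has on average `n ^ (-b)` initially open vertices. The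
threshold is at `b = 2 / θ + Θ(θ ^ (-3 / 2))`.

Lower bound: let `R` be about `√θ`, and call a line heavy if at least `d * R` of its vertices have
become open. If a plane fills up, consider the first time at which some plane contains `R` parallel
heavy lines. Just before a line becomes heavy, fewer than `R` of its vertices lie on heavy lines in
any given other direction, so `R` of its new vertices lie on no heavy line; these had all but
`O(R)` of the `θ` open neighbours they need already at time `0`. This gives `R` such vertices in
one plane, no two on a common line. Up to `2 * R` common neighbours each, their neighbourhoods are
disjoint, so `R * (θ - O(R))` initially open vertices lie in prescribed neighbourhoods of `R`
vertices of a plane, which a union bound shows to be unlikely.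

Upper bound: in a plane look for `k ≈ √θ` strong lines, having `s ≈ θ / 2` open vertices, and `θ`
weak lines, having `s - k` open vertices, in both directions. The strong lines open first their
intersections with each other, then with the weak lines; then the intersections of the weak lines
open, and finally everything. Strong lines are slightly rarer than one per plane but weak lines
are abundant, so among the `n` parallel planes in a third direction at least `θ` fill up, and these
open all other vertices.
-/

namespace HammingBootstrap

open MeasureTheory ProbabilityTheory

section Bernoulli

variable {V ι κ : Type*}

/-- The law of a random subset of `V` containing each vertex independently with probability `p`. -/
noncomputable abbrev bernoulliSubset (V : Type*) (p : unitInterval) : Measure (Set V) :=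
  setBernoulli (Set.univ : Set V) p

/-- The event `E` depends only on the restriction of the random set to `T`. -/
def DeterminedBy (E : Set (Set V)) (T : Set V) : Prop :=
  ∀ A B : Set V, (∀ v ∈ T, v ∈ A ↔ v ∈ B) → A ∈ E → B ∈ E

theorem DeterminedBy.inter {E F : Set (Set V)} {S T : Set V} (hE : DeterminedBy E S)
    (hF : DeterminedBy F T) : DeterminedBy (E ∩ F) (S ∪ T) :=
  fun A B hAB hA => ⟨hE A B (fun v hv => hAB v (Or.inl hv)) hA.1,
    hF A B (fun v hv => hAB v (Or.inr hv)) hA.2⟩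

theorem DeterminedBy.compl {E : Set (Set V)} {T : Set V} (hE : DeterminedBy E T) :
    DeterminedBy Eᶜ T :=
  fun A B hAB hA hB => hA (hE B A (fun v hv => (hAB v hv).symm) hB)

theorem DeterminedBy.biInter {E : ι → Set (Set V)} {T : ι → Set V} (s : Finset ι)
    (hE : ∀ j ∈ s, DeterminedBy (E j) (T j)) :
    DeterminedBy (⋂ j ∈ s, E j) (⋃ j ∈ s, T j) := by
  intro A B hAB hA
  simp only [Set.mem_iInter] at hA ⊢
  exact fun j hj => hE j hj A B (fun v hv => hAB v (Set.mem_biUnion hj hv)) (hA j hj)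

theorem DeterminedBy.biUnion {E : ι → Set (Set V)} {T : ι → Set V} (s : Finset ι)
    (hE : ∀ j ∈ s, DeterminedBy (E j) (T j)) :
    DeterminedBy (⋃ j ∈ s, E j) (⋃ j ∈ s, T j) := by
  intro A B hAB hA
  simp only [Set.mem_iUnion] at hA ⊢
  obtain ⟨j, hj, hA⟩ := hA
  exact ⟨j, hj, hE j hj A B (fun v hv => hAB v (Set.mem_biUnion hj hv)) hA⟩

theorem determinedBy_mem (v : V) : DeterminedBy {A : Set V | v ∈ A} {v} :=
  fun _ _ hAB hA => (hAB v rfl).1 hA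

/-- The law of independent labels of the vertices, uniform on the unit interval. The vertices with
label below `p` form a Bernoulli subset, which couples all values of `p`. -/
noncomputable abbrev uniformLabels (V : Type*) : Measure (V → unitInterval) :=
  Measure.infinitePi fun _ => volume

theorem measurable_lt (p : unitInterval) : Measurable fun u : unitInterval => u < p :=
  measurableSet_Iio.mem

theorem map_lt_volume (p : unitInterval) :
    (volume : Measure unitInterval).map (· < p) =
      unitInterval.toNNReal p • Measure.dirac True +
        unitInterval.toNNReal (unitInterval.symm p) • Measure.dirac False := by
  have hIio : (volume : Measure unitInterval) (Set.Iio p) = unitInterval.toNNReal p := by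
    rw [unitInterval.volume_Iio]
    exact ENNReal.ofReal_eq_coe_nnreal p.2.1
  have hIci : (volume : Measure unitInterval) (Set.Ici p) =
      unitInterval.toNNReal (unitInterval.symm p) := by
    rw [unitInterval.volume_Ici, ← unitInterval.coe_symm_eq]
    exact ENNReal.ofReal_eq_coe_nnreal (unitInterval.symm p).2.1
  refine Measure.ext_of_singleton fun a => ?_
  rw [Measure.map_apply (measurable_lt p) (measurableSet_singleton a)]
  by_cases ha : a
  · have : (· < p) ⁻¹' {a} = Set.Iio p := by ext; simp [ha]
    rw [this, hIio]
    simp [ha]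
  · have : (· < p) ⁻¹' {a} = Set.Ici p := by ext; simp [ha]
    rw [this, hIci]
    simp [ha]

theorem measurable_setOf_lt [Finite V] (p : unitInterval) :
    Measurable fun U : V → unitInterval => {v | U v < p} :=
  (Measurable.of_discrete (f := fun ω : V → Prop => {v | ω v})).comp
    (measurable_pi_lambda _ fun v => (measurable_lt p).comp (measurable_pi_apply v))

theorem bernoulliSubset_eq_map [Finite V] (p : unitInterval) :
    bernoulliSubset V p = (uniformLabels V).map fun U => {v | U v < p} := by
  rw [bernoulliSubset, setBernoulli_eq_map]
  simp only [Set.mem_univ, ← map_lt_volume]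
  rw [← Measure.infinitePi_map_pi _ fun _ => measurable_lt p, Measure.map_map .of_discrete]
  · rfl
  · exact measurable_pi_lambda _ fun v => (measurable_lt p).comp (measurable_pi_apply v)

theorem bernoulliSubset_apply [Finite V] (p : unitInterval) (E : Set (Set V)) :
    bernoulliSubset V p E = uniformLabels V {U | {v | U v < p} ∈ E} := by
  rw [bernoulliSubset_eq_map, Measure.map_apply (measurable_setOf_lt p) .of_discrete]
  rfl

theorem bernoulliSubset_mem [Finite V] (p : unitInterval) (v : V) :
    (bernoulliSubset V p).real {A | v ∈ A} = p := by
  have h := (measurePreserving_eval_infinitePi (fun _ : V => (volume : Measure unitInterval)) v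
    ).measure_preimage (measurableSet_Iio (a := p)).nullMeasurableSet
  rw [measureReal_def, bernoulliSubset_apply]
  exact (congrArg ENNReal.toReal (h.trans (unitInterval.volume_Iio p))).trans
    (ENNReal.toReal_ofReal p.2.1)

theorem DeterminedBy.setOf_lt_mem_iff {E : Set (Set V)} {S : Finset V} (hE : DeterminedBy E S)
    (p : unitInterval) (U : V → unitInterval) :
    {v | U v < p} ∈ E ↔ {v | ∃ h : v ∈ S, (fun w : S => U w) ⟨v, h⟩ < p} ∈ E := by
  constructor <;> refine hE _ _ fun v hv => ?_ <;> simp [Finset.mem_coe.1 hv]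

theorem bernoulliSubset_inter [Finite V] (p : unitInterval) {E F : Set (Set V)}
    {S T : Set V} (hE : DeterminedBy E S) (hF : DeterminedBy F T) (hST : Disjoint S T) :
    (bernoulliSubset V p).real (E ∩ F) =
      (bernoulliSubset V p).real E * (bernoulliSubset V p).real F := by
  obtain ⟨S, rfl⟩ := S.toFinite.exists_finset_coe
  obtain ⟨T, rfl⟩ := T.toFinite.exists_finset_coe
  have hmeas (E : Set (Set V)) (S : Finset V) :
      MeasurableSet {η : S → unitInterval | {v | ∃ h : v ∈ S, η ⟨v, h⟩ < p} ∈ E} :=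
    measurable_setOf_lt p
      (.of_discrete (s := {A : Set S | {v | ∃ h : v ∈ S, (⟨v, h⟩ : S) ∈ A} ∈ E}))
  have hindep := (iIndepFun_infinitePi (P := fun _ : V => (volume : Measure unitInterval))
    (X := fun _ => id) fun _ => measurable_id).indepFun_finset S T (Finset.disjoint_coe.1 hST)
    fun v => measurable_pi_apply v
  simp only [measureReal_def, ← ENNReal.toReal_mul, bernoulliSubset_apply, Set.mem_inter_iff,
    hE.setOf_lt_mem_iff, hF.setOf_lt_mem_iff]
  exact congrArg _ (hindep.measure_inter_preimage_eq_mul _ _ (hmeas E S) (hmeas F T))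

theorem bernoulliSubset_biInter [Finite V] (p : unitInterval) (s : Finset ι)
    {E : ι → Set (Set V)} {T : ι → Set V} (hE : ∀ j ∈ s, DeterminedBy (E j) (T j))
    (hT : (s : Set ι).PairwiseDisjoint T) :
    (bernoulliSubset V p).real (⋂ j ∈ s, E j) = ∏ j ∈ s, (bernoulliSubset V p).real (E j) := by
  classical
  induction s using Finset.induction_on with
  | empty => simp
  | insert a s ha ih =>
    rw [Finset.prod_insert ha, Finset.set_biInter_insert,
      bernoulliSubset_inter p (hE a (Finset.mem_insert_self _ _))
        (DeterminedBy.biInter s fun j hj => hE j (Finset.mem_insert_of_mem hj)),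
      ih (fun j hj => hE j (Finset.mem_insert_of_mem hj)) (hT.subset (by simp))]
    simp only [Set.disjoint_iUnion_right]
    exact fun j hj => hT (by simp) (by simp [hj]) fun h => ha (h ▸ hj)

theorem bernoulliSubset_subset [Finite V] (p : unitInterval) (U : Finset V) :
    (bernoulliSubset V p).real {A | (U : Set V) ⊆ A} = (p : ℝ) ^ U.card := by
  have h : {A : Set V | (U : Set V) ⊆ A} = ⋂ v ∈ U, {A | v ∈ A} := by
    ext A; simp [Set.subset_def]
  rw [h, bernoulliSubset_biInter p U (fun v _ => determinedBy_mem v)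
    fun a _ b _ hab => Set.disjoint_singleton.2 hab]
  simp only [bernoulliSubset_mem, Finset.prod_const]

theorem bernoulliSubset_le_ncard_inter [Finite V] (p : unitInterval) (T : Finset V) (u : ℕ) :
    (bernoulliSubset V p).real {A | u ≤ ((T : Set V) ∩ A).ncard} ≤ (T.card * p : ℝ) ^ u := by
  have hp : 0 ≤ (p : ℝ) := p.2.1
  have hsub : {A : Set V | u ≤ ((T : Set V) ∩ A).ncard} ⊆
      ⋃ U ∈ T.powersetCard u, {A | (U : Set V) ⊆ A} := by
    intro A hA
    obtain ⟨U, hU, hcard⟩ := Set.exists_subset_card_eq hA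
    obtain ⟨U, rfl⟩ := U.toFinite.exists_finset_coe
    rw [Set.ncard_coe_finset] at hcard
    exact Set.mem_biUnion
      (Finset.mem_powersetCard.2 ⟨Finset.coe_subset.1 (hU.trans Set.inter_subset_left), hcard⟩)
      (hU.trans Set.inter_subset_right)
  calc (bernoulliSubset V p).real {A | u ≤ ((T : Set V) ∩ A).ncard}
      ≤ ∑ U ∈ T.powersetCard u, (bernoulliSubset V p).real {A | (U : Set V) ⊆ A} :=
        (measureReal_mono hsub (measure_ne_top _ _)).trans (measureReal_biUnion_finset_le _ _)
    _ = ∑ _U ∈ T.powersetCard u, (p : ℝ) ^ u := Finset.sum_congr rfl fun U hU => by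
        rw [bernoulliSubset_subset, (Finset.mem_powersetCard.1 hU).2]
    _ = T.card.choose u * (p : ℝ) ^ u := by simp
    _ ≤ (T.card * p : ℝ) ^ u := by
        rw [mul_pow]
        gcongr
        exact_mod_cast Nat.choose_le_pow _ _

/-- The probability that at least one of `g` independent events of probability `q` occurs. -/
def hitProb (g : ℕ) (q : ℝ) : ℝ := 1 - (1 - q) ^ g

theorem bernoulliSubset_biUnion [Finite V] (p : unitInterval) (s : Finset ι)
    {E : ι → Set (Set V)} {T : ι → Set V} (hE : ∀ j ∈ s, DeterminedBy (E j) (T j))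
    (hT : (s : Set ι).PairwiseDisjoint T) {q : ℝ}
    (hq : ∀ j ∈ s, (bernoulliSubset V p).real (E j) = q) :
    (bernoulliSubset V p).real (⋃ j ∈ s, E j) = hitProb s.card q := by
  have hcompl : (⋃ j ∈ s, E j) = (⋂ j ∈ s, (E j)ᶜ)ᶜ := by simp
  rw [hcompl, probReal_compl_eq_one_sub .of_discrete,
    bernoulliSubset_biInter p s (fun j hj => (hE j hj).compl) hT, hitProb, ← Finset.prod_const]
  congr 1
  exact Finset.prod_congr rfl fun j hj => by rw [probReal_compl_eq_one_sub .of_discrete, hq j hj]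

theorem bernoulliSubset_biInter_biUnion [Finite V] (p : unitInterval) (s : Finset κ)
    {B : κ → Finset ι} (hB : (s : Set κ).PairwiseDisjoint B)
    {E : κ → ι → Set (Set V)} {T : ι → Set V}
    (hE : ∀ j ∈ s, ∀ x ∈ B j, DeterminedBy (E j x) (T x))
    (hT : Pairwise (Function.onFun Disjoint T)) {q : κ → ℝ}
    (hq : ∀ j ∈ s, ∀ x ∈ B j, (bernoulliSubset V p).real (E j x) = q j) :
    (bernoulliSubset V p).real (⋂ j ∈ s, ⋃ x ∈ B j, E j x) = ∏ j ∈ s, hitProb (B j).card (q j) := by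
  rw [bernoulliSubset_biInter p s (T := fun j => ⋃ x ∈ B j, T x)
    (fun j hj => DeterminedBy.biUnion _ (hE j hj))]
  · exact Finset.prod_congr rfl fun j hj =>
      bernoulliSubset_biUnion p (B j) (hE j hj) (fun _ _ _ _ hxy => hT hxy) (hq j hj)
  · intro i hi j hj hij
    simp only [Function.onFun, Set.disjoint_iUnion_left, Set.disjoint_iUnion_right]
    exact fun x hx y hy => hT fun h => Finset.disjoint_left.1 (hB hi hj hij) hy (h ▸ hx)

theorem uniformLabels_pi_Ico_pos [Finite V] {p q : unitInterval} (hpq : p < q) :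
    0 < uniformLabels V (Set.univ.pi fun _ => Set.Ico p q) := by
  have := Fintype.ofFinite V
  rw [Measure.infinitePi_pi_univ _ fun _ => measurableSet_Ico]
  simp only [unitInterval.volume_Ico, tprod_fintype]
  exact pos_iff_ne_zero.2 (Finset.prod_ne_zero_iff.2 fun _ _ => by simpa using hpq)

theorem bernoulliSubset_strictMono [Finite V] {E : Set (Set V)} (hE : IsUpperSet E)
    (hempty : ∅ ∉ E) (huniv : Set.univ ∈ E) :
    StrictMono fun p => (bernoulliSubset V p).real E := by
  intro p q hpq
  set box : Set (V → unitInterval) := Set.univ.pi fun _ => Set.Ico p q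
  have hsub : {U : V → unitInterval | {v | U v < p} ∈ E} ∪ box ⊆ {U | {v | U v < q} ∈ E} := by
    rintro U (hU | hU)
    · exact hE (fun v (hv : U v < p) => hv.trans hpq) hU
    · have : {v | U v < q} = Set.univ := Set.eq_univ_of_forall fun v => (hU v trivial).2
      simpa only [Set.mem_ofPred_eq, this] using huniv
  have hdisj : Disjoint {U : V → unitInterval | {v | U v < p} ∈ E} box := by
    refine Set.disjoint_left.2 fun U hU hbox => hempty ?_
    have : {v | U v < p} = ∅ := Set.eq_empty_of_forall_notMem fun v => (hbox v trivial).1.not_gt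
    simpa only [Set.mem_ofPred_eq, this] using hU
  have hle := measure_mono (μ := uniformLabels V) hsub
  rw [measure_union hdisj (MeasurableSet.univ_pi fun _ => measurableSet_Ico)] at hle
  simp only [measureReal_def, bernoulliSubset_apply]
  rw [ENNReal.toReal_lt_toReal (measure_ne_top _ _) (measure_ne_top _ _)]
  exact (ENNReal.lt_add_right (measure_ne_top _ _) (uniformLabels_pi_Ico_pos hpq).ne').trans_le hle

theorem bernoulliSubset_continuous [Finite V] (E : Set (Set V)) :
    Continuous fun p => (bernoulliSubset V p).real E := by
  have h (p : unitInterval) : (bernoulliSubset V p).real E =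
      ∑ A ∈ E.toFinite.toFinset, (p : ℝ) ^ A.ncard * (1 - p : ℝ) ^ (Set.univ \ A).ncard := by
    rw [← Set.Finite.coe_toFinset E.toFinite, ← sum_measureReal_singleton]
    simp
  simp only [h]
  fun_prop

end Bernoulli

section Dynamics

variable {V κ : Type*} {G : SimpleGraph V} {θ : ℕ} {A B : Set V}

theorem openAt_succ (j : ℕ) : openAt G θ A (j + 1) = bootstrapStep G θ (openAt G θ A j) :=
  Function.iterate_succ_apply' _ _ _

theorem openAt_mono : Monotone (openAt G θ A) := by
  refine monotone_nat_of_le_succ fun j => ?_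
  rw [openAt_succ]
  exact fun v hv => Or.inl hv

theorem openAt_mono_initial (h : A ⊆ B) (j : ℕ) : openAt G θ A j ⊆ openAt G θ B j := by
  induction j with
  | zero => exact h
  | succ j ih =>
    rw [openAt_succ, openAt_succ]
    rintro v (hv | hv)
    · exact Or.inl (ih hv)
    · exact Or.inr (hv.trans (Set.encard_le_encard (Set.inter_subset_inter_right _ ih)))

theorem subset_finalOpen : A ⊆ finalOpen G θ A :=
  fun _ hv => Set.mem_iUnion.2 ⟨0, hv⟩

theorem finalOpen_mono_initial (h : A ⊆ B) : finalOpen G θ A ⊆ finalOpen G θ B :=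
  Set.iUnion_mono fun j => openAt_mono_initial h j

theorem finalOpen_empty (hθ : 0 < θ) : finalOpen G θ ∅ = ∅ := by
  refine Set.iUnion_eq_empty.2 fun j => ?_
  induction j with
  | zero => rfl
  | succ j ih =>
    rw [openAt_succ, ih]
    simp [bootstrapStep, hθ.ne']

theorem exists_subset_openAt {S : Set V} (hfin : S.Finite) (hS : S ⊆ finalOpen G θ A) :
    ∃ j, S ⊆ openAt G θ A j := by
  obtain ⟨S, rfl⟩ := hfin.exists_finset_coe
  exact Directed.exists_mem_subset_of_finset_subset_biUnion openAt_mono.directed_le hS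

theorem mem_finalOpen_of_le_card {v : V} {S : Finset V} (hS : (S : Set V) ⊆ finalOpen G θ A)
    (hadj : ∀ w ∈ S, w = v ∨ G.Adj v w) (hcard : θ ≤ S.card) : v ∈ finalOpen G θ A := by
  by_cases hv : v ∈ S
  · exact hS hv
  obtain ⟨j, hj⟩ := exists_subset_openAt S.finite_toSet hS
  have hsub : (S : Set V) ⊆ G.neighborSet v ∩ openAt G θ A j :=
    fun w hw => ⟨(hadj w hw).resolve_left fun h => hv (h ▸ hw), hj hw⟩
  refine Set.mem_iUnion.2 ⟨j + 1, ?_⟩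
  rw [openAt_succ]
  refine Or.inr (le_trans ?_ (Set.encard_le_encard hsub))
  rw [Set.encard_coe_eq_coe_finsetCard]
  exact_mod_cast hcard

/-- The vertices that are open at time `t` but not initially open. -/
def newlyOpen (G : SimpleGraph V) (θ : ℕ) (A : Set V) (t : ℕ) : Set V :=
  openAt G θ A t \ A

/-- The vertex `w` has all but `D` of the `θ` open neighbours it needs already at time zero. -/
def AlmostOpen (G : SimpleGraph V) (θ : ℕ) (A : Set V) (D : ℕ) (w : V) : Prop :=
  θ ≤ (G.neighborSet w ∩ A).ncard + D

theorem newlyOpen_zero : newlyOpen G θ A 0 = ∅ :=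
  Set.sdiff_self

theorem le_encard_of_mem_newlyOpen_succ {v : V} {t : ℕ} (hv : v ∈ newlyOpen G θ A (t + 1)) :
    (θ : ℕ∞) ≤ (G.neighborSet v ∩ openAt G θ A t).encard := by
  induction t with
  | zero => exact hv.1.resolve_left hv.2
  | succ t ih =>
    obtain ⟨hv, hvA⟩ := hv
    rw [openAt_succ] at hv
    rcases hv with hv | hv
    · exact (ih ⟨hv, hvA⟩).trans (Set.encard_le_encard
        (Set.inter_subset_inter_right _ (openAt_mono (Nat.le_succ t))))
    · exact hv

theorem almostOpen_of_mem_newlyOpen_succ [Finite V] {v : V} {t : ℕ}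
    (hv : v ∈ newlyOpen G θ A (t + 1)) :
    AlmostOpen G θ A (G.neighborSet v ∩ newlyOpen G θ A t).ncard v := by
  have hle := le_encard_of_mem_newlyOpen_succ hv
  rw [← (Set.toFinite _).cast_ncard_eq, Nat.cast_le] at hle
  refine hle.trans ((Set.ncard_le_ncard ?_ (Set.toFinite _)).trans (Set.ncard_union_le _ _))
  rw [← Set.inter_union_distrib_left, newlyOpen, Set.union_sdiff_self]
  exact Set.inter_subset_inter_right _ Set.subset_union_right

/-- The neighbours of the `k`-th vertex of a family that are not adjacent to any other member. -/
def privateNeighbors (G : SimpleGraph V) (w : κ → V) (k : κ) : Set V :=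
  {y | G.Adj (w k) y ∧ ∀ l ≠ k, ¬ G.Adj (w l) y}

theorem pairwise_disjoint_privateNeighbors (w : κ → V) :
    Pairwise (Function.onFun Disjoint (privateNeighbors G w)) :=
  fun k _ hkl => Set.disjoint_left.2 fun _ hy hy' => hy'.2 k hkl hy.1

theorem ncard_neighborSet_inter_le_privateNeighbors [Finite V] [Fintype κ] {w : κ → V} {k : κ}
    {c : ℕ} (hc : ∀ l ≠ k, (G.commonNeighbors (w k) (w l)).ncard ≤ c) (A : Set V) :
    (G.neighborSet (w k) ∩ A).ncard ≤
      (privateNeighbors G w k ∩ A).ncard + Fintype.card κ * c := by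
  have hsub : G.neighborSet (w k) ∩ A ⊆
      (privateNeighbors G w k ∩ A) ∪ ⋃ l, ⋃ _ : l ≠ k, G.commonNeighbors (w k) (w l) := by
    rintro y ⟨hy, hyA⟩
    by_cases h : ∃ l ≠ k, G.Adj (w l) y
    · obtain ⟨l, hl, hadj⟩ := h
      exact Or.inr (Set.mem_iUnion₂.2 ⟨l, hl, hy, hadj⟩)
    · push Not at h
      exact Or.inl ⟨⟨hy, h⟩, hyA⟩
  refine (Set.ncard_le_ncard hsub (Set.toFinite _)).trans ((Set.ncard_union_le _ _).trans ?_)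
  refine Nat.add_le_add_left ((Set.ncard_iUnion_le_of_fintype _).trans ?_) _
  refine (Finset.sum_le_card_nsmul _ _ c fun l _ => ?_).trans_eq (by simp)
  by_cases hl : l = k
  · simp [hl]
  · simpa [hl] using hc l hl

theorem determinedBy_le_ncard_inter (T : Set V) (u : ℕ) :
    DeterminedBy {A | u ≤ (T ∩ A).ncard} T := by
  intro A B hAB hA
  have : T ∩ A = T ∩ B := Set.ext fun v => and_congr_right fun hv => hAB v hv
  simpa [← this] using hA

theorem bernoulliSubset_forall_le_ncard_privateNeighbors [Finite V] [Fintype κ]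
    (p : unitInterval) (w : κ → V) (u : ℕ) {D : ℕ} (hD : ∀ v, (G.neighborSet v).ncard ≤ D) :
    (bernoulliSubset V p).real {A | ∀ k, u ≤ (privateNeighbors G w k ∩ A).ncard} ≤
      ((D * p : ℝ) ^ u) ^ Fintype.card κ := by
  have hp : 0 ≤ (p : ℝ) := p.2.1
  have hInter : {A | ∀ k, u ≤ (privateNeighbors G w k ∩ A).ncard} =
      ⋂ k ∈ (Finset.univ : Finset κ), {A | u ≤ (privateNeighbors G w k ∩ A).ncard} := by
    ext A
    simp
  rw [hInter, bernoulliSubset_biInter p _ (fun k _ => determinedBy_le_ncard_inter _ u)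
    fun k _ l _ hkl => pairwise_disjoint_privateNeighbors w hkl]
  refine (Finset.prod_le_prod (fun _ _ => measureReal_nonneg) fun k _ => ?_).trans_eq
    (Finset.prod_const _)
  have hfin := Set.toFinite (privateNeighbors G w k)
  have h := bernoulliSubset_le_ncard_inter p hfin.toFinset u
  rw [Set.Finite.coe_toFinset, ← Set.ncard_eq_toFinset_card] at h
  refine h.trans ?_
  gcongr
  exact (Set.ncard_le_ncard (fun y hy => hy.1) (Set.toFinite _)).trans (hD (w k))

end Dynamics

section Torus

variable {n d i θ : ℕ}

theorem adj_update {v : Fin d → Fin n} {e : Fin d} {x : Fin n} (hx : x ≠ v e) :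
    (hammingTorus n d).Adj v (Function.update v e x) := by
  change hammingDist _ _ = 1
  rw [hammingDist, Finset.card_eq_one]
  refine ⟨e, Finset.ext fun j => ?_⟩
  by_cases hj : j = e
  · subst hj; simpa using hx.symm
  · simp [hj]

theorem exists_eq_update_of_adj {v w : Fin d → Fin n} (h : (hammingTorus n d).Adj v w) :
    ∃ e x, w = Function.update v e x := by
  change hammingDist _ _ = 1 at h
  obtain ⟨e, he⟩ := Finset.card_eq_one.1 h
  refine ⟨e, w e, funext fun j => ?_⟩
  by_cases hj : j = e
  · subst hj; simp
  · have : j ∉ ({e} : Finset (Fin d)) := by simpa using hj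
    rw [← he] at this
    simpa [hj, eq_comm] using this

theorem ncard_neighborSet_inter_le_sum (v : Fin d → Fin n) (B : Set (Fin d → Fin n)) :
    ((hammingTorus n d).neighborSet v ∩ B).ncard ≤
      ∑ e, {x : Fin n | Function.update v e x ∈ B}.ncard := by
  have hsub : (hammingTorus n d).neighborSet v ∩ B ⊆
      ⋃ e, Function.update v e '' {x | Function.update v e x ∈ B} := by
    rintro y ⟨hy, hyB⟩
    obtain ⟨e, x, rfl⟩ := exists_eq_update_of_adj hy
    exact Set.mem_iUnion.2 ⟨e, x, hyB, rfl⟩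
  refine (Set.ncard_le_ncard hsub (Set.toFinite _)).trans
    ((Set.ncard_iUnion_le_of_fintype _).trans (Finset.sum_le_sum fun e _ => ?_))
  exact Set.ncard_image_le (Set.toFinite _)

theorem ncard_neighborSet_le (v : Fin d → Fin n) :
    ((hammingTorus n d).neighborSet v).ncard ≤ d * n := by
  simpa using ncard_neighborSet_inter_le_sum v Set.univ

/-- The point with coordinates `x` in direction `e` and `y` in direction `e'` of the plane through
`a` in these two directions. -/
def planePoint (a : Fin d → Fin n) (e e' : Fin d) (x y : Fin n) : Fin d → Fin n :=
  Function.update (Function.update a e' y) e x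

variable {a : Fin d → Fin n} {e e' : Fin d}

theorem planePoint_comm (he : e ≠ e') (x y : Fin n) :
    planePoint a e e' x y = planePoint a e' e y x :=
  Function.update_comm he.symm _ _ _

theorem planePoint_apply_left (x y : Fin n) : planePoint a e e' x y e = x :=
  Function.update_self ..

theorem planePoint_apply_right (he : e ≠ e') (x y : Fin n) : planePoint a e e' x y e' = y := by
  rw [planePoint_comm he, planePoint_apply_left]

theorem update_planePoint_left (x y x' : Fin n) :
    Function.update (planePoint a e e' x y) e x' = planePoint a e e' x' y :=
  Function.update_idem ..

theorem update_planePoint_right (he : e ≠ e') (x y y' : Fin n) :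
    Function.update (planePoint a e e' x y) e' y' = planePoint a e e' x y' := by
  rw [planePoint_comm he, update_planePoint_left, planePoint_comm he.symm]

theorem planePoint_self (a : Fin d → Fin n) (e e' : Fin d) :
    planePoint a e e' (a e) (a e') = a := by
  simp [planePoint]

theorem eq_or_adj_planePoint_left (x y x' : Fin n) :
    planePoint a e e' x' y = planePoint a e e' x y ∨
      (hammingTorus n d).Adj (planePoint a e e' x y) (planePoint a e e' x' y) := by
  refine (eq_or_ne x' x).imp (fun h => by rw [h]) fun h => ?_
  rw [← update_planePoint_left x y x']
  exact adj_update (by rwa [planePoint_apply_left])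

theorem eq_or_adj_planePoint_right (he : e ≠ e') (x y y' : Fin n) :
    planePoint a e e' x y' = planePoint a e e' x y ∨
      (hammingTorus n d).Adj (planePoint a e e' x y) (planePoint a e e' x y') := by
  simpa only [planePoint_comm he] using eq_or_adj_planePoint_left (a := a) (e' := e) y x y'

theorem eq_planePoint_of_adj_of_adj (he : e ≠ e') {x₁ x₂ y₁ y₂ : Fin n} (hx : x₁ ≠ x₂)
    (hy : y₁ ≠ y₂) {w : Fin d → Fin n} (h₁ : (hammingTorus n d).Adj (planePoint a e e' x₁ y₁) w)
    (h₂ : (hammingTorus n d).Adj (planePoint a e e' x₂ y₂) w) :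
    w = planePoint a e e' x₂ y₁ ∨ w = planePoint a e e' x₁ y₂ := by
  obtain ⟨b, s, rfl⟩ := exists_eq_update_of_adj h₁
  obtain ⟨c, t, hbc⟩ := exists_eq_update_of_adj h₂
  have hxe := congrFun hbc e
  have hye := congrFun hbc e'
  -- The two points differ in directions `e` and `e'`, so one step goes along each of them.
  by_cases hb : b = e
  · subst hb
    have hc : c = e' := by
      by_contra hc
      rw [Function.update_of_ne he.symm, Function.update_of_ne (Ne.symm hc),
        planePoint_apply_right he, planePoint_apply_right he] at hye
      exact hy hye
    subst hc
    rw [Function.update_self, Function.update_of_ne he, planePoint_apply_left] at hxe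
    exact Or.inl (by rw [hxe, update_planePoint_left])
  · have hc : c = e := by
      by_contra hc
      rw [Function.update_of_ne (Ne.symm hb), Function.update_of_ne (Ne.symm hc),
        planePoint_apply_left, planePoint_apply_left] at hxe
      exact hx hxe
    subst hc
    have hb' : b = e' := by
      by_contra hb'
      rw [Function.update_of_ne (Ne.symm hb'), Function.update_of_ne he.symm,
        planePoint_apply_right he, planePoint_apply_right he] at hye
      exact hy hye
    subst hb'
    rw [Function.update_self, Function.update_of_ne he.symm, planePoint_apply_right he] at hye
    exact Or.inr (by rw [hye, update_planePoint_right he])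

theorem ncard_commonNeighbors_planePoint_le (he : e ≠ e') {x₁ x₂ y₁ y₂ : Fin n} (hx : x₁ ≠ x₂)
    (hy : y₁ ≠ y₂) :
    ((hammingTorus n d).commonNeighbors (planePoint a e e' x₁ y₁)
      (planePoint a e e' x₂ y₂)).ncard ≤ 2 := by
  have hsub : (hammingTorus n d).commonNeighbors (planePoint a e e' x₁ y₁)
      (planePoint a e e' x₂ y₂) ⊆ {planePoint a e e' x₂ y₁, planePoint a e e' x₁ y₂} :=
    fun w hw => eq_planePoint_of_adj_of_adj he hx hy hw.1 hw.2
  exact (Set.ncard_le_ncard hsub (Set.toFinite _)).trans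
    ((Set.ncard_insert_le _ _).trans (by simp))

theorem IsSubtorus.exists_planePoint_mem {F : Set (Fin d → Fin n)} (hF : IsSubtorus i F)
    (hi : 2 ≤ i) : ∃ a e e', e ≠ e' ∧ ∀ x y, planePoint a e e' x y ∈ F := by
  obtain ⟨S, a, rfl, rfl⟩ := hF
  obtain ⟨e, he, e', he', hne⟩ := Finset.one_lt_card.1 hi
  refine ⟨a, e, e', hne, fun x y j hj => ?_⟩
  rw [planePoint, Function.update_of_ne (ne_of_mem_of_not_mem he hj).symm,
    Function.update_of_ne (ne_of_mem_of_not_mem he' hj).symm]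

theorem isUpperSet_someSubtorusOpen : IsUpperSet (someSubtorusOpen n d i θ) :=
  fun _ _ hAB ⟨F, hF, hFA⟩ => ⟨F, hF, hFA.trans (finalOpen_mono_initial hAB)⟩

theorem mem_someSubtorusOpen_of_finalOpen_eq_univ (hid : i ≤ d) (hn : 0 < n)
    {A : Set (Fin d → Fin n)} (h : finalOpen (hammingTorus n d) θ A = Set.univ) :
    A ∈ someSubtorusOpen n d i θ := by
  obtain ⟨S, -, hS⟩ := Finset.exists_subset_card_eq (s := (Finset.univ : Finset (Fin d))) (n := i)
    (by simpa using hid)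
  exact ⟨_, ⟨S, fun _ => ⟨0, hn⟩, hS, rfl⟩, by simp [h]⟩

theorem univ_mem_someSubtorusOpen (hid : i ≤ d) (hn : 0 < n) :
    Set.univ ∈ someSubtorusOpen n d i θ :=
  mem_someSubtorusOpen_of_finalOpen_eq_univ hid hn (Set.univ_subset_iff.1 subset_finalOpen)

theorem empty_notMem_someSubtorusOpen (hθ : 0 < θ) : ∅ ∉ someSubtorusOpen n d i θ := by
  rintro ⟨F, ⟨S, a, -, rfl⟩, hF⟩
  rw [finalOpen_empty hθ] at hF
  exact hF (show a ∈ _ from fun _ _ => rfl)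

theorem probSubtorusOpen_strictMono (hid : i ≤ d) (hn : 0 < n) (hθ : 0 < θ) :
    StrictMono (probSubtorusOpen n d i θ) :=
  bernoulliSubset_strictMono isUpperSet_someSubtorusOpen (empty_notMem_someSubtorusOpen hθ)
    (univ_mem_someSubtorusOpen hid hn)

theorem existsUnique_isThreshold (hid : i ≤ d) (hn : 0 < n) (hθ : 0 < θ) :
    ∃! p, IsThreshold n d i θ p := by
  have hcont : Continuous (probSubtorusOpen n d i θ) := bernoulliSubset_continuous _
  have hzero : probSubtorusOpen n d i θ 0 = 0 := by
    simp [probSubtorusOpen, measureReal_def, empty_notMem_someSubtorusOpen hθ]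
  have hone : probSubtorusOpen n d i θ 1 = 1 := by
    simp [probSubtorusOpen, measureReal_def, univ_mem_someSubtorusOpen hid hn]
  obtain ⟨p, hp⟩ := mem_range_of_exists_le_of_exists_ge hcont (c := 1 / 2)
    ⟨0, by rw [hzero]; norm_num⟩ ⟨1, by rw [hone]; norm_num⟩
  exact ⟨p, hp, fun q hq => (probSubtorusOpen_strictMono hid hn hθ).injective (hq.trans hp.symm)⟩

end Torus

section Crowding

variable {n d i θ : ℕ} {A : Set (Fin d → Fin n)}

/-- The line through `v` in direction `e` contains at least `M` newly open vertices. -/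
def Heavy (θ : ℕ) (A : Set (Fin d → Fin n)) (M t : ℕ) (v : Fin d → Fin n) (e : Fin d) : Prop :=
  M ≤ {x : Fin n | Function.update v e x ∈ newlyOpen (hammingTorus n d) θ A t}.ncard

/-- Some two-dimensional subgraph contains `R` parallel heavy lines. -/
def Crowded (θ : ℕ) (A : Set (Fin d → Fin n)) (M R t : ℕ) : Prop :=
  ∃ (v : Fin d → Fin n) (e e' : Fin d), e ≠ e' ∧
    R ≤ {y : Fin n | Heavy θ A M t (Function.update v e' y) e}.ncard

theorem not_heavy_zero {M : ℕ} (hM : 0 < M) (v : Fin d → Fin n) (e : Fin d) :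
    ¬ Heavy θ A M 0 v e := by
  simp [Heavy, newlyOpen_zero, hM.ne']

theorem heavy_update_iff {M t : ℕ} {v : Fin d → Fin n} {e : Fin d} (x : Fin n) :
    Heavy θ A M t (Function.update v e x) e ↔ Heavy θ A M t v e := by
  simp only [Heavy, Function.update_idem]

theorem almostOpen_or_exists_heavy {M t : ℕ} {w : Fin d → Fin n}
    (hw : w ∈ newlyOpen (hammingTorus n d) θ A (t + 1)) :
    AlmostOpen (hammingTorus n d) θ A (d * M) w ∨ ∃ e, Heavy θ A M t w e := by
  refine or_iff_not_imp_right.2 fun hlight => ?_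
  have hcard : ((hammingTorus n d).neighborSet w ∩
      newlyOpen (hammingTorus n d) θ A t).ncard ≤ d * M :=
    (ncard_neighborSet_inter_le_sum w _).trans <|
      (Finset.sum_le_card_nsmul _ _ M fun e _ =>
        (not_le.1 fun h => hlight ⟨e, h⟩).le).trans_eq (by simp)
  exact (almostOpen_of_mem_newlyOpen_succ hw).trans (Nat.add_le_add_left hcard _)

theorem heavy_or_le_ncard_almostOpen_of_heavy_succ {R t : ℕ} (hc : ¬ Crowded θ A (d * R) R t)
    {v : Fin d → Fin n} {e : Fin d} (hv : Heavy θ A (d * R) (t + 1) v e) :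
    Heavy θ A (d * R) t v e ∨ R ≤ {x : Fin n |
      AlmostOpen (hammingTorus n d) θ A (d * (d * R)) (Function.update v e x)}.ncard := by
  by_contra! hcon
  obtain ⟨hlight, hfew⟩ := hcon
  -- Newly open vertices of the line are almost open or lie on a heavy transversal line.
  set f : Fin d → Set (Fin n) := Function.update
    (fun e' => {x | Heavy θ A (d * R) t (Function.update v e x) e'}) e
    {x | AlmostOpen (hammingTorus n d) θ A (d * (d * R)) (Function.update v e x)} with hf
  have hcover : {x : Fin n | Function.update v e x ∈ newlyOpen (hammingTorus n d) θ A (t + 1)} ⊆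
      ⋃ e', f e' := by
    intro x hx
    obtain h | ⟨e', he'⟩ := almostOpen_or_exists_heavy (M := d * R) hx
    · exact Set.mem_iUnion.2 ⟨e, by rwa [hf, Function.update_self]⟩
    · have hne : e' ≠ e := by
        rintro rfl
        exact hlight ((heavy_update_iff x).1 he')
      exact Set.mem_iUnion.2 ⟨e', by rwa [hf, Function.update_of_ne hne]⟩
  have hsmall (e' : Fin d) : (f e').ncard < R := by
    by_cases he : e' = e
    · rwa [he, hf, Function.update_self]
    · rw [hf, Function.update_of_ne he]
      exact not_le.1 fun h => hc ⟨v, e', e, he, h⟩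
  have hlt : ∑ e', (f e').ncard < d * R :=
    (Finset.sum_lt_sum_of_nonempty ⟨e, Finset.mem_univ e⟩ fun e' _ => hsmall e').trans_eq (by simp)
  exact hlt.not_ge (hv.trans ((Set.ncard_le_ncard hcover (Set.toFinite _)).trans
    (Set.ncard_iUnion_le_of_fintype _)))

theorem le_ncard_almostOpen_of_heavy {R t : ℕ} (hR : 0 < R)
    (hc : ∀ r < t, ¬ Crowded θ A (d * R) R r) {v : Fin d → Fin n} {e : Fin d}
    (hv : Heavy θ A (d * R) t v e) :
    R ≤ {x : Fin n |
      AlmostOpen (hammingTorus n d) θ A (d * (d * R)) (Function.update v e x)}.ncard := by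
  induction t with
  | zero => exact absurd hv (not_heavy_zero (Nat.mul_pos e.pos hR) v e)
  | succ t ih =>
    exact (heavy_or_le_ncard_almostOpen_of_heavy_succ (hc t t.lt_succ_self) hv).elim
      (ih fun r hr => hc r (hr.trans t.lt_succ_self)) id

theorem exists_crowded {M R : ℕ} (hi : 2 ≤ i) (hR : R ≤ n)
    (hA : ∀ (v : Fin d → Fin n) (e : Fin d), {x | Function.update v e x ∈ A}.ncard + M ≤ n)
    (h : A ∈ someSubtorusOpen n d i θ) : ∃ t, Crowded θ A M R t := by
  obtain ⟨F, hF, hFA⟩ := h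
  obtain ⟨a, e, e', hee, hplane⟩ := hF.exists_planePoint_mem hi
  obtain ⟨t, ht⟩ := exists_subset_openAt F.toFinite hFA
  have hheavy (y : Fin n) : Heavy θ A M t (Function.update a e' y) e := by
    have hcompl : {x | Function.update (Function.update a e' y) e x ∈ A}ᶜ ⊆
        {x | Function.update (Function.update a e' y) e x ∈ newlyOpen (hammingTorus n d) θ A t} :=
      fun x hx => ⟨ht (hplane x y), hx⟩
    have hle := Set.ncard_le_ncard hcompl (Set.toFinite _)
    have hadd := Set.ncard_add_ncard_compl {x | Function.update (Function.update a e' y) e x ∈ A}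
    have hline := hA (Function.update a e' y) e
    rw [Nat.card_eq_fintype_card, Fintype.card_fin] at hadd
    exact (by omega : M ≤ _).trans hle
  exact ⟨t, a, e, e', hee, by simpa [hheavy] using hR⟩

theorem exists_injective_of_card_le_ncard {α κ : Type*} [Finite α] [Fintype κ] (T : κ → Set α)
    (hT : ∀ k, Fintype.card κ ≤ (T k).ncard) :
    ∃ f : κ → α, Function.Injective f ∧ ∀ k, f k ∈ T k := by
  classical
  obtain ⟨f, hf, hfT⟩ := (Finset.all_card_le_biUnion_card_iff_exists_injective
    fun k => (T k).toFinite.toFinset).1 fun s => by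
      rcases s.eq_empty_or_nonempty with rfl | ⟨k, hk⟩
      · simp
      · refine s.card_le_univ.trans ((hT k).trans ?_)
        rw [Set.ncard_eq_toFinset_card]
        exact Finset.card_le_card
          (Finset.subset_biUnion_of_mem (fun k => (T k).toFinite.toFinset) hk)
  exact ⟨f, hf, fun k => by simpa using hfT k⟩

theorem exists_almostOpen_transversal {R : ℕ} (hi : 2 ≤ i) (hR0 : 0 < R) (hR : R ≤ n)
    (hA : ∀ (v : Fin d → Fin n) (e : Fin d), {x | Function.update v e x ∈ A}.ncard + d * R ≤ n)
    (h : A ∈ someSubtorusOpen n d i θ) :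
    ∃ (v : Fin d → Fin n) (e e' : Fin d) (x y : Fin R → Fin n), e ≠ e' ∧
      Function.Injective x ∧ Function.Injective y ∧ ∀ k,
        AlmostOpen (hammingTorus n d) θ A (d * (d * R)) (planePoint v e e' (x k) (y k)) := by
  classical
  have hex := exists_crowded hi hR hA h
  obtain ⟨v, e, e', hee, hcard⟩ := Nat.find_spec hex
  obtain ⟨y, hy, hheavy⟩ := exists_injective_of_card_le_ncard
    (fun _ : Fin R => {y : Fin n | Heavy θ A (d * R) (Nat.find hex) (Function.update v e' y) e})
    fun _ => by simpa using hcard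
  obtain ⟨x, hx, halmost⟩ := exists_injective_of_card_le_ncard (fun k : Fin R => {x : Fin n |
      AlmostOpen (hammingTorus n d) θ A (d * (d * R)) (planePoint v e e' x (y k))}) fun k => by
    rw [Fintype.card_fin]
    exact le_ncard_almostOpen_of_heavy hR0 (fun r hr => Nat.find_min hex hr) (hheavy k)
  exact ⟨v, e, e', x, y, hee, hx, hy, halmost⟩

theorem exists_forall_le_ncard_privateNeighbors {R u : ℕ} (hi : 2 ≤ i) (hR0 : 0 < R) (hR : R ≤ n)
    (hu : u + d * (d * R) + 2 * R ≤ θ)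
    (hA : ∀ (v : Fin d → Fin n) (e : Fin d), {x | Function.update v e x ∈ A}.ncard + d * R ≤ n)
    (h : A ∈ someSubtorusOpen n d i θ) :
    ∃ (v : Fin d → Fin n) (e e' : Fin d) (x y : Fin R → Fin n), ∀ k, u ≤ (privateNeighbors
      (hammingTorus n d) (fun l => planePoint v e e' (x l) (y l)) k ∩ A).ncard := by
  obtain ⟨v, e, e', x, y, hee, hx, hy, halmost⟩ := exists_almostOpen_transversal hi hR0 hR hA h
  refine ⟨v, e, e', x, y, fun k => ?_⟩
  have hopen : θ ≤ _ + d * (d * R) := halmost k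
  have hprivate := ncard_neighborSet_inter_le_privateNeighbors (A := A)
    (w := fun l => planePoint v e e' (x l) (y l)) (k := k) fun l hl =>
      ncard_commonNeighbors_planePoint_le hee (hx.ne hl.symm) (hy.ne hl.symm)
  rw [Fintype.card_fin] at hprivate
  omega

theorem bernoulliSubset_le_ncard_line (p : unitInterval) (v : Fin d → Fin n) (e : Fin d) (L : ℕ) :
    (bernoulliSubset (Fin d → Fin n) p).real
      {A | L ≤ {x | Function.update v e x ∈ A}.ncard} ≤ (n * p : ℝ) ^ L := by
  classical
  have hinj := Function.update_injective v e
  have hline := bernoulliSubset_le_ncard_inter p (Finset.univ.map ⟨_, hinj⟩) L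
  simp only [Finset.card_map, Finset.card_univ, Fintype.card_fin] at hline
  refine le_trans (measureReal_mono fun A hA => ?_) hline
  refine le_trans (show L ≤ _ from hA) ?_
  rw [← Set.ncard_image_of_injective _ hinj]
  refine Set.ncard_le_ncard ?_ (Set.toFinite _)
  rintro _ ⟨x, hx, rfl⟩
  exact ⟨by simp, hx⟩

theorem probSubtorusOpen_le {R u L : ℕ} (hi : 2 ≤ i) (hR0 : 0 < R) (hR : R ≤ n)
    (hL : L + d * R ≤ n) (hu : u + d * (d * R) + 2 * R ≤ θ) (p : unitInterval) :
    probSubtorusOpen n d i θ p ≤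
      (n : ℝ) ^ d * d * d * n ^ R * n ^ R * ((d * n * p : ℝ) ^ u) ^ R +
        (n : ℝ) ^ d * d * (n * p : ℝ) ^ L := by
  let E : (Fin d → Fin n) × Fin d × Fin d × (Fin R → Fin n) × (Fin R → Fin n) →
      Set (Set (Fin d → Fin n)) := fun ⟨v, e, e', x, y⟩ =>
    {A | ∀ k, u ≤ (privateNeighbors (hammingTorus n d)
      (fun l => planePoint v e e' (x l) (y l)) k ∩ A).ncard}
  let F : (Fin d → Fin n) × Fin d → Set (Set (Fin d → Fin n)) := fun ⟨v, e⟩ =>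
    {A | L ≤ {x | Function.update v e x ∈ A}.ncard}
  have hsub : someSubtorusOpen n d i θ ⊆ (⋃ c, E c) ∪ ⋃ c, F c := by
    intro A hA
    by_cases hline : ∃ v e, L ≤ {x | Function.update v e x ∈ A}.ncard
    · obtain ⟨v, e, hve⟩ := hline
      exact Or.inr (Set.mem_iUnion.2 ⟨(v, e), hve⟩)
    · push Not at hline
      obtain ⟨v, e, e', x, y, h⟩ := exists_forall_le_ncard_privateNeighbors hi hR0 hR hu
        (fun v e => by have := hline v e; omega) hA
      exact Or.inl (Set.mem_iUnion.2 ⟨(v, e, e', x, y), h⟩)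
  have hE (c) : (bernoulliSubset _ p).real (E c) ≤ ((d * n * p : ℝ) ^ u) ^ R := by
    simpa only [Fintype.card_fin, Nat.cast_mul] using
      bernoulliSubset_forall_le_ncard_privateNeighbors p
        (fun l => planePoint c.1 c.2.1 c.2.2.1 (c.2.2.2.1 l) (c.2.2.2.2 l)) u ncard_neighborSet_le
  refine (measureReal_mono hsub).trans ((measureReal_union_le _ _).trans (add_le_add ?_ ?_)) <;>
    refine (measureReal_iUnion_fintype_le _).trans ?_
  · refine (Finset.sum_le_card_nsmul _ _ _ fun c _ => hE c).trans_eq ?_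
    simp only [Finset.card_univ, Fintype.card_prod, Fintype.card_pi, Fintype.card_fin,
      Finset.prod_const, nsmul_eq_mul]
    push_cast
    ring
  · refine (Finset.sum_le_card_nsmul _ _ _ fun c _ =>
      bernoulliSubset_le_ncard_line p c.1 c.2 L).trans_eq ?_
    simp

end Crowding

section Blocks

variable {n g : ℕ} {V : Type*}

/-- The `j`-th block of `g` consecutive elements of `Fin n`. -/
def block (n g j : ℕ) : Finset (Fin n) := {x | (x : ℕ) / g = j}

theorem mem_block {j : ℕ} {x : Fin n} : x ∈ block n g j ↔ (x : ℕ) / g = j := by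
  simp [block]

theorem disjoint_block {i j : ℕ} (hij : i ≠ j) : Disjoint (block n g i) (block n g j) :=
  Finset.disjoint_left.2 fun _ hx hy => hij ((mem_block.1 hx).symm.trans (mem_block.1 hy))

theorem card_block {j : ℕ} (hg : 0 < g) (hj : (j + 1) * g ≤ n) : (block n g j).card = g := by
  have h : (block n g j).map Fin.valEmbedding = Finset.Ico (j * g) ((j + 1) * g) := by
    ext x
    simp only [Finset.mem_map, mem_block, Fin.valEmbedding_apply, Finset.mem_Ico,
      ← Nat.le_div_iff_mul_le hg, ← Nat.div_lt_iff_lt_mul hg]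
    constructor
    · rintro ⟨y, rfl, rfl⟩
      exact ⟨le_rfl, Nat.lt_succ_self _⟩
    · rintro ⟨hle, hlt⟩
      exact ⟨⟨x, ((Nat.div_lt_iff_lt_mul hg).1 hlt).trans_le hj⟩,
        le_antisymm (Nat.le_of_lt_succ hlt) hle, rfl⟩
  rw [← Finset.card_map Fin.valEmbedding, h, Nat.card_Ico, Nat.succ_mul, Nat.add_sub_cancel_left]

/-- For each index `j ∈ J`, one of the events `E j x` with `x` in the `j`-th block occurs. -/
def blockEvent (g : ℕ) (J : Finset ℕ) (E : ℕ → Fin n → Set (Set V)) : Set (Set V) :=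
  ⋂ j ∈ J, ⋃ x ∈ block n g j, E j x

variable {J : Finset ℕ} {E : ℕ → Fin n → Set (Set V)}

theorem mem_blockEvent {A : Set V} :
    A ∈ blockEvent g J E ↔ ∀ j ∈ J, ∃ x ∈ block n g j, A ∈ E j x := by
  simp [blockEvent]

theorem DeterminedBy.blockEvent {T : Fin n → Set V} {S : Set V}
    (hE : ∀ j x, DeterminedBy (E j x) (T x)) (hT : ∀ x : Fin n, (x : ℕ) / g ∈ J → T x ⊆ S) :
    DeterminedBy (blockEvent g J E) S := by
  intro A B hAB hA
  rw [mem_blockEvent] at hA ⊢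
  intro j hj
  obtain ⟨x, hx, hAx⟩ := hA j hj
  have hxS : T x ⊆ S := hT x (by rwa [mem_block.1 hx])
  exact ⟨x, hx, hE j x A B (fun v hv => hAB v (hxS hv)) hAx⟩

theorem bernoulliSubset_blockEvent [Finite V] (p : unitInterval) (hg : 0 < g)
    (hJ : ∀ j ∈ J, (j + 1) * g ≤ n) {T : Fin n → Set V} (hE : ∀ j x, DeterminedBy (E j x) (T x))
    (hT : Pairwise (Function.onFun Disjoint T)) {q : ℕ → ℝ}
    (hq : ∀ j ∈ J, ∀ x, (bernoulliSubset V p).real (E j x) = q j) :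
    (bernoulliSubset V p).real (blockEvent g J E) = ∏ j ∈ J, hitProb g (q j) := by
  refine (bernoulliSubset_biInter_biUnion p J (fun _ _ _ _ => disjoint_block)
    (fun j _ x _ => hE j x) hT fun j hj x _ => hq j hj x).trans ?_
  exact Finset.prod_congr rfl fun j hj => by rw [card_block hg (hJ j hj)]

theorem exists_finset_of_mem_blockEvent {A : Set V} (hA : A ∈ blockEvent g J E) :
    ∃ S : Finset (Fin n), S.card = J.card ∧ ∀ x ∈ S, (x : ℕ) / g ∈ J ∧ A ∈ E ((x : ℕ) / g) x := by
  classical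
  choose f hf hfA using mem_blockEvent.1 hA
  have hinj : Function.Injective fun j : J => f j.1 j.2 := fun j j' h =>
    Subtype.ext <| (mem_block.1 (hf j.1 j.2)).symm.trans
      ((congrArg (fun x : Fin n => (x : ℕ) / g) h).trans (mem_block.1 (hf j'.1 j'.2)))
  refine ⟨J.attach.image fun j => f j.1 j.2, ?_, fun x hx => ?_⟩
  · rw [Finset.card_image_of_injective _ hinj, Finset.card_attach]
  · obtain ⟨⟨j, hj⟩, -, rfl⟩ := Finset.mem_image.1 hx
    rw [mem_block.1 (hf j hj)]
    exact ⟨hj, hfA j hj⟩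

theorem blockEvent_subset_of_subset {J' : Finset ℕ} (h : J' ⊆ J) :
    blockEvent g J E ⊆ blockEvent g J' E :=
  Set.biInter_mono h fun _ _ => le_rfl

end Blocks

section PlaneFilling

variable {n d i θ g s k m : ℕ} {e e' f : Fin d} {a v : Fin d → Fin n} {A : Set (Fin d → Fin n)}

/-- The line through `v` in direction `e` has an open vertex in each of the `m` blocks from
`2 * θ` on. -/
def lineEvent (θ g m : ℕ) (e : Fin d) (v : Fin d → Fin n) : Set (Set (Fin d → Fin n)) :=
  blockEvent g (Finset.Ico (2 * θ) (2 * θ + m)) fun _ x => {A | Function.update v e x ∈ A}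

/-- In the plane through `a` in directions `e` and `e'`, each of the first `θ` blocks of direction
`e'` contains a weak line in direction `e`, one with `s - k` open vertices in distinct blocks, and
each of the next `k` blocks contains a strong line, one with `s`. The lines are only inspected
from block `2 * θ` on, so that exchanging `e` and `e'` gives an independent event. -/
def linesEvent (θ g s k : ℕ) (e e' : Fin d) (a : Fin d → Fin n) : Set (Set (Fin d → Fin n)) :=
  blockEvent g (Finset.range (θ + k)) fun j y =>
    lineEvent θ g (if j < θ then s - k else s) e (Function.update a e' y)

/-- The plane through `a` in directions `e` and `e'` has enough weak and strong lines in both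
directions. -/
def planeEvent (θ g s k : ℕ) (e e' : Fin d) (a : Fin d → Fin n) : Set (Set (Fin d → Fin n)) :=
  linesEvent θ g s k e e' a ∩ linesEvent θ g s k e' e a

/-- Among the planes in directions `e` and `e'` that meet the line through `a` in direction `f`,
each of the first `θ` blocks contains one with enough weak and strong lines. -/
def stackEvent (θ g s k : ℕ) (e e' f : Fin d) (a : Fin d → Fin n) : Set (Set (Fin d → Fin n)) :=
  blockEvent g (Finset.range θ) fun _ z => planeEvent θ g s k e e' (Function.update a f z)

theorem forall_of_strong_weak_lines {X Y : Type*} {Q : X → Y → Prop}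
    (hQ : ∀ x y (R : Finset X) (C : Finset Y), (∀ x' ∈ R, Q x' y) → (∀ y' ∈ C, Q x y') →
      θ ≤ R.card + C.card → Q x y)
    (hs : θ ≤ 2 * s) {S W : Finset X} {S' W' : Finset Y}
    (hS : k ≤ S.card) (hS' : k ≤ S'.card) (hW : θ ≤ W.card) (hW' : θ ≤ W'.card)
    (hrow : ∀ y ∈ S', ∃ C : Finset X, s ≤ C.card ∧ Disjoint C S ∧ ∀ x ∈ C, Q x y)
    (hcol : ∀ x ∈ S, ∃ D : Finset Y, s ≤ D.card ∧ Disjoint D S' ∧ ∀ y ∈ D, Q x y)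
    (hrow' : ∀ y ∈ W', ∃ C : Finset X, s ≤ C.card + k ∧ Disjoint C S ∧ ∀ x ∈ C, Q x y)
    (hcol' : ∀ x ∈ W, ∃ D : Finset Y, s ≤ D.card + k ∧ Disjoint D S' ∧ ∀ y ∈ D, Q x y)
    (x : X) (y : Y) : Q x y := by
  classical
  have union_row {y C} (hC : ∀ x ∈ C, Q x y) (h : ∀ x ∈ S, Q x y) : ∀ x ∈ C ∪ S, Q x y :=
    fun x hx => (Finset.mem_union.1 hx).elim (hC x) (h x)
  have union_col {x D} (hD : ∀ y ∈ D, Q x y) (h : ∀ y ∈ S', Q x y) : ∀ y ∈ D ∪ S', Q x y :=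
    fun y hy => (Finset.mem_union.1 hy).elim (hD y) (h y)
  have hstrong : ∀ x ∈ S, ∀ y ∈ S', Q x y := by
    intro x hx y hy
    obtain ⟨C, hCs, -, hC⟩ := hrow y hy
    obtain ⟨D, hDs, -, hD⟩ := hcol x hx
    exact hQ x y C D hC hD (by omega)
  have hcol_weak : ∀ x ∈ S, ∀ y ∈ W', Q x y := by
    intro x hx y hy
    obtain ⟨C, hCs, -, hC⟩ := hrow' y hy
    obtain ⟨D, hDs, hdisj, hD⟩ := hcol x hx
    refine hQ x y C (D ∪ S') hC (union_col hD (hstrong x hx)) ?_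
    rw [Finset.card_union_of_disjoint hdisj]
    omega
  have hrow_weak : ∀ x ∈ W, ∀ y ∈ S', Q x y := by
    intro x hx y hy
    obtain ⟨C, hCs, hdisj, hC⟩ := hrow y hy
    obtain ⟨D, hDs, -, hD⟩ := hcol' x hx
    refine hQ x y (C ∪ S) D (union_row hC fun x hx => hstrong x hx y hy) hD ?_
    rw [Finset.card_union_of_disjoint hdisj]
    omega
  have hweak : ∀ x ∈ W, ∀ y ∈ W', Q x y := by
    intro x hx y hy
    obtain ⟨C, hCs, hCdisj, hC⟩ := hrow' y hy
    obtain ⟨D, hDs, hDdisj, hD⟩ := hcol' x hx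
    refine hQ x y (C ∪ S) (D ∪ S') (union_row hC fun x hx => hcol_weak x hx y hy)
      (union_col hD (hrow_weak x hx)) ?_
    rw [Finset.card_union_of_disjoint hCdisj, Finset.card_union_of_disjoint hDdisj]
    omega
  have hfull_row : ∀ x, ∀ y ∈ W', Q x y := fun x y hy =>
    hQ x y W ∅ (fun x' hx' => hweak x' hx' y hy) (by simp) (by simpa using hW)
  exact hQ x y ∅ W' (by simp) (hfull_row x) (by simpa using hW')

theorem planePoint_mem_finalOpen_of_le_card (he : e ≠ e') {x y : Fin n} {R C : Finset (Fin n)}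
    (hR : ∀ x' ∈ R, planePoint a e e' x' y ∈ finalOpen (hammingTorus n d) θ A)
    (hC : ∀ y' ∈ C, planePoint a e e' x y' ∈ finalOpen (hammingTorus n d) θ A)
    (hcard : θ ≤ R.card + C.card) :
    planePoint a e e' x y ∈ finalOpen (hammingTorus n d) θ A := by
  classical
  by_cases hx : x ∈ R
  · exact hR x hx
  have hinj : Function.Injective fun x' => planePoint a e e' x' y := fun x₁ x₂ h => by
    simpa only [planePoint_apply_left] using congrFun h e
  have hinj' : Function.Injective (planePoint a e e' x) := fun y₁ y₂ h => by
    simpa only [planePoint_apply_right he] using congrFun h e'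
  have hdisj : Disjoint (R.image fun x' => planePoint a e e' x' y)
      (C.image (planePoint a e e' x)) := by
    simp only [Finset.disjoint_left, Finset.mem_image]
    rintro _ ⟨x', hx', rfl⟩ ⟨y', -, h⟩
    have hxx := congrFun h e
    rw [planePoint_apply_left, planePoint_apply_left] at hxx
    exact hx (hxx ▸ hx')
  refine mem_finalOpen_of_le_card (S := R.image (fun x' => planePoint a e e' x' y) ∪
    C.image (planePoint a e e' x)) ?_ ?_ ?_
  · rw [Finset.coe_union, Finset.coe_image, Finset.coe_image, Set.union_subset_iff,
      Set.image_subset_iff, Set.image_subset_iff]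
    exact ⟨hR, hC⟩
  · simp only [Finset.mem_union, Finset.mem_image]
    rintro _ (⟨x', -, rfl⟩ | ⟨y', -, rfl⟩)
    · exact eq_or_adj_planePoint_left x y x'
    · exact eq_or_adj_planePoint_right he x y y'
  · rwa [Finset.card_union_of_disjoint hdisj, Finset.card_image_of_injective _ hinj,
      Finset.card_image_of_injective _ hinj']

theorem exists_finset_of_mem_lineEvent (h : A ∈ lineEvent θ g m e v) {S : Finset (Fin n)}
    (hS : ∀ x ∈ S, (x : ℕ) / g < 2 * θ) :
    ∃ C : Finset (Fin n), C.card = m ∧ Disjoint C S ∧ ∀ x ∈ C, Function.update v e x ∈ A := by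
  obtain ⟨C, hCcard, hC⟩ := exists_finset_of_mem_blockEvent h
  refine ⟨C, by simpa using hCcard, Finset.disjoint_left.2 fun x hxC hxS => ?_,
    fun x hx => (hC x hx).2⟩
  exact (hS x hxS).not_ge (Finset.mem_Ico.1 (hC x hxC).1).1

theorem exists_lines_of_mem_linesEvent (h : A ∈ linesEvent θ g s k e e' a) :
    ∃ S W : Finset (Fin n), S.card = k ∧ W.card = θ ∧ (∀ y ∈ S, (y : ℕ) / g < θ + k) ∧
      (∀ y ∈ S, A ∈ lineEvent θ g s e (Function.update a e' y)) ∧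
      ∀ y ∈ W, A ∈ lineEvent θ g (s - k) e (Function.update a e' y) := by
  obtain ⟨S, hScard, hS⟩ := exists_finset_of_mem_blockEvent
    (blockEvent_subset_of_subset (J' := Finset.Ico θ (θ + k)) (by grind) h)
  obtain ⟨W, hWcard, hW⟩ := exists_finset_of_mem_blockEvent
    (blockEvent_subset_of_subset (J' := Finset.range θ) (by grind) h)
  refine ⟨S, W, by simpa using hScard, by simpa using hWcard,
    fun y hy => (Finset.mem_Ico.1 (hS y hy).1).2, fun y hy => ?_, fun y hy => ?_⟩
  · simpa only [(Finset.mem_Ico.1 (hS y hy).1).1.not_gt, if_false] using (hS y hy).2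
  · simpa only [Finset.mem_range.1 (hW y hy).1, if_true] using (hW y hy).2

theorem mem_finalOpen_of_mem_planeEvent (hs : θ ≤ 2 * s) (hk : k ≤ θ) (he : e ≠ e')
    (h : A ∈ planeEvent θ g s k e e' a) : a ∈ finalOpen (hammingTorus n d) θ A := by
  obtain ⟨S', W', hScard', hWcard', hSg', hS', hW'⟩ := exists_lines_of_mem_linesEvent h.1
  obtain ⟨S, W, hScard, hWcard, hSg, hS, hW⟩ := exists_lines_of_mem_linesEvent h.2
  have hrow {m : ℕ} (y : Fin n)
      (hy : A ∈ lineEvent θ g (s - m) e (Function.update a e' y)) : ∃ C : Finset (Fin n),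
      s ≤ C.card + m ∧ Disjoint C S ∧
        ∀ x ∈ C, planePoint a e e' x y ∈ finalOpen (hammingTorus n d) θ A := by
    obtain ⟨C, hcard, hdisj, hC⟩ := exists_finset_of_mem_lineEvent hy (S := S) fun x hx => by
      have := hSg x hx; omega
    exact ⟨C, by omega, hdisj, fun x hx => subset_finalOpen (hC x hx)⟩
  have hcol {m : ℕ} (x : Fin n)
      (hx : A ∈ lineEvent θ g (s - m) e' (Function.update a e x)) : ∃ D : Finset (Fin n),
      s ≤ D.card + m ∧ Disjoint D S' ∧
        ∀ y ∈ D, planePoint a e e' x y ∈ finalOpen (hammingTorus n d) θ A := by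
    obtain ⟨D, hcard, hdisj, hD⟩ := exists_finset_of_mem_lineEvent hx (S := S') fun y hy => by
      have := hSg' y hy; omega
    exact ⟨D, by omega, hdisj, fun y hy => by
      rw [planePoint_comm he]; exact subset_finalOpen (hD y hy)⟩
  rw [← planePoint_self a e e']
  exact forall_of_strong_weak_lines
    (Q := fun x y => planePoint a e e' x y ∈ finalOpen (hammingTorus n d) θ A)
    (fun x y R C => planePoint_mem_finalOpen_of_le_card he) hs
    hScard.ge hScard'.ge hWcard.ge hWcard'.ge
    (fun y hy => hrow (m := 0) y (hS' y hy)) (fun x hx => hcol (m := 0) x (hS x hx))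
    (fun y hy => hrow y (hW' y hy)) (fun x hx => hcol x (hW x hx)) (a e) (a e')

theorem mem_finalOpen_of_mem_stackEvent (hs : θ ≤ 2 * s) (hk : k ≤ θ) (he : e ≠ e')
    (h : A ∈ stackEvent θ g s k e e' f a) : a ∈ finalOpen (hammingTorus n d) θ A := by
  classical
  obtain ⟨Z, hcard, hZ⟩ := exists_finset_of_mem_blockEvent h
  refine mem_finalOpen_of_le_card (S := Z.image (Function.update a f)) ?_ ?_ ?_
  · rw [Finset.coe_image, Set.image_subset_iff]
    exact fun z hz => mem_finalOpen_of_mem_planeEvent hs hk he (hZ z hz).2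
  · simp only [Finset.mem_image]
    rintro _ ⟨z, -, rfl⟩
    exact (eq_or_ne z (a f)).imp (fun h => by rw [h, Function.update_eq_self]) adj_update
  · rw [Finset.card_image_of_injective _ (Function.update_injective _ _), hcard,
      Finset.card_range]

end PlaneFilling

section Supercritical

variable {n d i θ g s k m : ℕ} {e e' f : Fin d}

theorem pairwise_disjoint_of_apply_eq {T : Fin n → Set (Fin d → Fin n)} (e : Fin d)
    (hT : ∀ x, ∀ w ∈ T x, w e = x) : Pairwise (Function.onFun Disjoint T) :=
  fun x y hxy => Set.disjoint_left.2 fun w hx hy => hxy ((hT x w hx).symm.trans (hT y w hy))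

/-- The vertices of the line through `v` in direction `e` that `lineEvent` inspects. -/
def lineSupport (θ g : ℕ) (e : Fin d) (v : Fin d → Fin n) : Set (Fin d → Fin n) :=
  {w | (∀ j, j ≠ e → w j = v j) ∧ 2 * θ ≤ (w e : ℕ) / g}

/-- The vertices of the plane through `a` in directions `e` and `e'` that `linesEvent` inspects. -/
def linesSupport (θ g : ℕ) (e e' : Fin d) (a : Fin d → Fin n) : Set (Fin d → Fin n) :=
  {w | (∀ j, j ≠ e → j ≠ e' → w j = a j) ∧ (w e' : ℕ) / g < 2 * θ ∧ 2 * θ ≤ (w e : ℕ) / g}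

theorem determinedBy_lineEvent (θ g m : ℕ) (e : Fin d) (v : Fin d → Fin n) :
    DeterminedBy (lineEvent θ g m e v) (lineSupport θ g e v) := by
  refine DeterminedBy.blockEvent (fun _ x => determinedBy_mem (Function.update v e x))
    fun x hx => ?_
  rw [Set.singleton_subset_iff]
  refine ⟨fun j hj => Function.update_of_ne hj _ _, ?_⟩
  rw [Function.update_self]
  exact (Finset.mem_Ico.1 hx).1

theorem determinedBy_linesEvent (hk : k ≤ θ) (g s : ℕ) (he : e ≠ e') (a : Fin d → Fin n) :
    DeterminedBy (linesEvent θ g s k e e' a) (linesSupport θ g e e' a) := by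
  refine DeterminedBy.blockEvent (fun _ y =>
    determinedBy_lineEvent θ g _ e (Function.update a e' y)) fun y hy w ⟨hw, hwe⟩ => ?_
  refine ⟨fun j hj hj' => by rw [hw j hj, Function.update_of_ne hj'], ?_, hwe⟩
  rw [hw e' he.symm, Function.update_self]
  have := Finset.mem_range.1 hy
  omega

theorem determinedBy_planeEvent (hk : k ≤ θ) (g s : ℕ) (he : e ≠ e') (a : Fin d → Fin n) :
    DeterminedBy (planeEvent θ g s k e e' a) {w | ∀ j, j ≠ e → j ≠ e' → w j = a j} := by
  intro A B hAB hA
  refine (determinedBy_linesEvent hk g s he a).inter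
    (determinedBy_linesEvent hk g s he.symm a) A B (fun w hw => hAB w ?_) hA
  exact hw.elim (fun h => h.1) fun h j hj hj' => h.1 j hj' hj

theorem bernoulliSubset_lineEvent (hg : 0 < g) (hm : m ≤ θ) (hn : 3 * θ * g ≤ n)
    (p : unitInterval) (e : Fin d) (v : Fin d → Fin n) :
    (bernoulliSubset (Fin d → Fin n) p).real (lineEvent θ g m e v) = hitProb g p ^ m := by
  refine (bernoulliSubset_blockEvent p hg (T := fun x => {Function.update v e x})
    (q := fun _ => p) (fun j hj => ?_) (fun _ x => determinedBy_mem _)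
    (pairwise_disjoint_of_apply_eq e ?_) (fun _ _ x => bernoulliSubset_mem p _)).trans (by simp)
  · have := Finset.mem_Ico.1 hj
    exact (Nat.mul_le_mul_right g (by omega)).trans hn
  · rintro x _ rfl
    exact Function.update_self ..

/-- The probability that a plane has enough weak and strong lines in one of its directions. -/
def linesProb (θ g s k : ℕ) (p : ℝ) : ℝ :=
  hitProb g (hitProb g p ^ (s - k)) ^ θ * hitProb g (hitProb g p ^ s) ^ k

theorem bernoulliSubset_linesEvent (hg : 0 < g) (hs : s ≤ θ) (hk : k ≤ θ) (hn : 3 * θ * g ≤ n)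
    (p : unitInterval) (he : e ≠ e') (a : Fin d → Fin n) :
    (bernoulliSubset (Fin d → Fin n) p).real (linesEvent θ g s k e e' a) = linesProb θ g s k p := by
  have hprod := bernoulliSubset_blockEvent p hg
    (J := Finset.range (θ + k)) (T := fun y => lineSupport θ g e (Function.update a e' y))
    (q := fun j => hitProb g p ^ (if j < θ then s - k else s))
    (fun j hj => (Nat.mul_le_mul_right g (by have := Finset.mem_range.1 hj; omega)).trans hn)
    (fun j y => determinedBy_lineEvent θ g (if j < θ then s - k else s) e (Function.update a e' y))
    (pairwise_disjoint_of_apply_eq e' fun y w hw =>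
      (hw.1 e' he.symm).trans (Function.update_self ..))
    (fun j _ y => bernoulliSubset_lineEvent hg (by split_ifs <;> omega) hn p e _)
  refine hprod.trans ?_
  rw [Finset.prod_range_add, linesProb]
  congr 1
  · rw [Finset.prod_congr rfl fun j hj => by rw [if_pos (Finset.mem_range.1 hj)]]
    simp
  · simp

theorem bernoulliSubset_planeEvent (hg : 0 < g) (hs : s ≤ θ) (hk : k ≤ θ) (hn : 3 * θ * g ≤ n)
    (p : unitInterval) (he : e ≠ e') (a : Fin d → Fin n) :
    (bernoulliSubset (Fin d → Fin n) p).real (planeEvent θ g s k e e' a) =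
      linesProb θ g s k p ^ 2 := by
  have hdisj : Disjoint (linesSupport θ g e e' a) (linesSupport θ g e' e a) :=
    Set.disjoint_left.2 fun w hw hw' => hw.2.1.not_ge hw'.2.2
  rw [planeEvent, bernoulliSubset_inter p (determinedBy_linesEvent hk g s he a)
    (determinedBy_linesEvent hk g s he.symm a) hdisj, bernoulliSubset_linesEvent hg hs hk hn p he,
    bernoulliSubset_linesEvent hg hs hk hn p he.symm, sq]

theorem bernoulliSubset_stackEvent (hg : 0 < g) (hs : s ≤ θ) (hk : k ≤ θ) (hn : 3 * θ * g ≤ n)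
    (p : unitInterval) (he : e ≠ e') (hfe : f ≠ e) (hfe' : f ≠ e') (a : Fin d → Fin n) :
    (bernoulliSubset (Fin d → Fin n) p).real (stackEvent θ g s k e e' f a) =
      hitProb g (linesProb θ g s k p ^ 2) ^ θ := by
  refine (bernoulliSubset_blockEvent p hg (q := fun _ => linesProb θ g s k p ^ 2)
    (T := fun z => {w | ∀ j, j ≠ e → j ≠ e' → w j = Function.update a f z j}) (fun j hj => ?_)
    (fun _ z => determinedBy_planeEvent hk g s he _) (pairwise_disjoint_of_apply_eq f fun z w hw =>
      (hw f hfe hfe').trans (Function.update_self ..))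
    (fun _ _ z => bernoulliSubset_planeEvent hg hs hk hn p he _)).trans (by simp)
  have := Finset.mem_range.1 hj
  exact (Nat.mul_le_mul_right g (by omega)).trans hn

theorem le_probSubtorusOpen (hid : i ≤ d) (hd : 3 ≤ d) (hg : 0 < g) (hθs : θ ≤ 2 * s)
    (hs : s ≤ θ) (hk : k ≤ θ) (hn : 3 * θ * g ≤ n) (hn0 : 0 < n) (p : unitInterval) :
    1 - (n : ℝ) ^ d * (1 - hitProb g (linesProb θ g s k p ^ 2) ^ θ) ≤
      probSubtorusOpen n d i θ p := by
  let e : Fin d := ⟨0, by omega⟩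
  let e' : Fin d := ⟨1, by omega⟩
  let f : Fin d := ⟨2, by omega⟩
  have hee : e ≠ e' := by simp [e, e']
  have hsub : (someSubtorusOpen n d i θ)ᶜ ⊆ ⋃ a, (stackEvent θ g s k e e' f a)ᶜ := by
    rw [← Set.compl_iInter, Set.compl_subset_compl]
    exact fun A hA => mem_someSubtorusOpen_of_finalOpen_eq_univ hid hn0 <|
      Set.eq_univ_of_forall fun a =>
        mem_finalOpen_of_mem_stackEvent hθs hk hee (Set.mem_iInter.1 hA a)
  rw [sub_le_comm]
  calc 1 - probSubtorusOpen n d i θ p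
      = (bernoulliSubset (Fin d → Fin n) p).real (someSubtorusOpen n d i θ)ᶜ :=
        (probReal_compl_eq_one_sub .of_discrete).symm
    _ ≤ ∑ a, (bernoulliSubset (Fin d → Fin n) p).real (stackEvent θ g s k e e' f a)ᶜ :=
        (measureReal_mono hsub).trans (measureReal_iUnion_fintype_le _)
    _ = (n : ℝ) ^ d * (1 - hitProb g (linesProb θ g s k p ^ 2) ^ θ) := by
        have hstack (a : Fin d → Fin n) := bernoulliSubset_stackEvent hg hs hk hn p hee
          (f := f) (by simp [e, f]) (by simp [e', f]) a
        simp only [probReal_compl_eq_one_sub MeasurableSet.of_discrete, hstack]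
        simp [mul_sub]

end Supercritical

section Subcritical

open Filter Topology

variable {n d i θ R u : ℕ} {b : ℝ}

/-- The density `n ^ (-1 - b)`, at which a line of `[n] ^ d` has on average `n ^ (-b)` open
vertices. Projecting onto the unit interval makes it a `unitInterval` element for all `b` and `n`;
for `0 ≤ b` and `0 < n` the value is unchanged. -/
noncomputable def density (b : ℝ) (n : ℕ) : unitInterval :=
  Set.projIcc 0 1 zero_le_one ((n : ℝ) ^ (-1 - b))

theorem coe_density (hb : 0 ≤ b) (hn : 0 < n) : (density b n : ℝ) = (n : ℝ) ^ (-1 - b) := by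
  have hmem : (n : ℝ) ^ (-1 - b) ∈ Set.Icc (0 : ℝ) 1 :=
    ⟨by positivity, Real.rpow_le_one_of_one_le_of_nonpos (mod_cast hn) (by linarith)⟩
  rw [density, Set.projIcc_of_mem zero_le_one hmem]

theorem natCast_mul_density (hb : 0 ≤ b) (hn : 0 < n) : n * (density b n : ℝ) = (n : ℝ) ^ (-b) := by
  have hn' : (0 : ℝ) < n := mod_cast hn
  rw [coe_density hb hn, sub_eq_add_neg, Real.rpow_add hn', Real.rpow_neg_one,
    mul_inv_cancel_left₀ hn'.ne']

theorem tendsto_probSubtorusOpen_density_zero (hi : 2 ≤ i) (hR : 0 < R)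
    (hu : u + d * (d * R) + 2 * R ≤ θ) (hb : d + 2 * R < b * (u * R)) :
    Tendsto (fun n => probSubtorusOpen n d i θ (density b n)) atTop (𝓝 0) := by
  have hb0 : 0 < b := pos_of_mul_pos_left (hb.trans_le' (by positivity)) (by positivity)
  obtain ⟨L, hL⟩ := exists_nat_gt (d / b)
  rw [div_lt_iff₀' hb0] at hL
  have hbound : ∀ᶠ n : ℕ in atTop, probSubtorusOpen n d i θ (density b n) ≤
      d * d * (d : ℝ) ^ (u * R) * (n : ℝ) ^ (-(b * (u * R) - (d + 2 * R))) +
        d * (n : ℝ) ^ (-(b * L - d)) := by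
    filter_upwards [eventually_ge_atTop (L + d * R), eventually_ge_atTop R] with n hLn hRn
    have hn : 0 < n := hR.trans_le hRn
    have hn' : (0 : ℝ) < n := mod_cast hn
    have hpow (m : ℕ) : (n * density b n : ℝ) ^ m = (n : ℝ) ^ (-b * m) := by
      rw [natCast_mul_density hb0.le hn, Real.rpow_mul hn'.le, Real.rpow_natCast]
    refine (probSubtorusOpen_le hi hR hRn hLn hu _).trans_eq ?_
    rw [mul_assoc (d : ℝ) (n : ℝ), ← pow_mul, mul_pow (d : ℝ), hpow, hpow, neg_sub, neg_sub,
      sub_eq_add_neg, sub_eq_add_neg, Real.rpow_add hn', Real.rpow_add hn', Real.rpow_add hn',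
      two_mul, Real.rpow_add hn']
    simp only [Real.rpow_natCast, Nat.cast_mul, neg_mul]
    ring
  have hlim {a : ℝ} (ha : 0 < a) : Tendsto (fun n : ℕ => (n : ℝ) ^ (-a)) atTop (𝓝 0) :=
    (tendsto_rpow_neg_atTop ha).comp tendsto_natCast_atTop_atTop
  refine squeeze_zero' (.of_forall fun _ => measureReal_nonneg) hbound ?_
  simpa using ((hlim (sub_pos.2 hb)).const_mul _).add ((hlim (sub_pos.2 hL)).const_mul _)

theorem two_div_add_div_rpow_eq (C : ℝ) (θ : ℕ) :
    2 / (θ : ℝ) + C / (θ : ℝ) ^ (3 / 2 : ℝ) = 2 / √(θ : ℝ) ^ 2 + C / √(θ : ℝ) ^ 3 := by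
  rw [Real.rpow_div_two_eq_sqrt _ θ.cast_nonneg, Real.sq_sqrt θ.cast_nonneg]
  norm_cast

theorem subcritical_exponent {d r R : ℝ} (hd : 1 ≤ d) (hr : 8 * d ^ 2 ≤ r) (hrR : r ≤ R)
    (hRr : R ≤ r + 1) :
    d + 2 * R < (2 / r ^ 2 + 100 * d ^ 2 / r ^ 3) * ((r ^ 2 - 2 * d ^ 2 * R) * R) := by
  have hd2 : d ≤ d ^ 2 := le_self_pow₀ hd two_ne_zero
  have hr0 : 0 < r := by linarith
  have hu : r * (r - 4 * d ^ 2) ≤ r ^ 2 - 2 * d ^ 2 * R := by nlinarith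
  have hbu : 2 + 2 * d ^ 2 / r ≤
      (2 / r ^ 2 + 100 * d ^ 2 / r ^ 3) * (r ^ 2 - 2 * d ^ 2 * R) := by
    refine le_trans ?_ (mul_le_mul_of_nonneg_left hu (by positivity))
    field_simp
    nlinarith
  have hdR : 2 * d ^ 2 ≤ 2 * d ^ 2 / r * R := by
    rw [div_mul_eq_mul_div, le_div_iff₀ hr0]
    gcongr
  calc d + 2 * R < (2 + 2 * d ^ 2 / r) * R := by linarith
    _ ≤ _ := by
      rw [← mul_assoc]
      exact mul_le_mul_of_nonneg_right hbu (hr0.le.trans hrR)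

theorem tendsto_probSubtorusOpen_zero (hi : 2 ≤ i) (hd : 2 ≤ d) (hθ : 64 * d ^ 4 ≤ θ) :
    Tendsto (fun n => probSubtorusOpen n d i θ
      (density (2 / (θ : ℝ) + 100 * d ^ 2 / (θ : ℝ) ^ (3 / 2 : ℝ)) n)) atTop (𝓝 0) := by
  have hd1 : (1 : ℝ) ≤ d := by exact_mod_cast (by omega : 1 ≤ d)
  have hr : 8 * (d : ℝ) ^ 2 ≤ √θ :=
    Real.le_sqrt_of_sq_le (by rw [mul_pow, ← pow_mul]; norm_num; exact_mod_cast hθ)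
  have hr0 : 0 < √(θ : ℝ) := hr.trans_lt' (by positivity)
  have hRr : (⌈√(θ : ℝ)⌉₊ : ℝ) ≤ √θ + 1 := (Nat.ceil_lt_add_one hr0.le).le
  obtain ⟨u, hu⟩ : ∃ u, θ = 2 * d ^ 2 * ⌈√(θ : ℝ)⌉₊ + u := by
    refine Nat.exists_eq_add_of_le ?_
    have : 2 * (d : ℝ) ^ 2 * ⌈√(θ : ℝ)⌉₊ ≤ θ := by
      calc 2 * (d : ℝ) ^ 2 * ⌈√(θ : ℝ)⌉₊ ≤ 2 * d ^ 2 * (2 * √θ) := by gcongr; nlinarith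
        _ ≤ √θ * √θ := by nlinarith
        _ = θ := Real.mul_self_sqrt θ.cast_nonneg
    exact_mod_cast this
  refine tendsto_probSubtorusOpen_density_zero (u := u) hi (Nat.ceil_pos.2 hr0) ?_ ?_
  · have : 2 * ⌈√(θ : ℝ)⌉₊ ≤ d ^ 2 * ⌈√(θ : ℝ)⌉₊ := Nat.mul_le_mul_right _ (by nlinarith)
    linarith
  · have huR : (u : ℝ) = √θ ^ 2 - 2 * d ^ 2 * ⌈√(θ : ℝ)⌉₊ := by
      rw [Real.sq_sqrt θ.cast_nonneg, eq_sub_iff_add_eq']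
      exact_mod_cast hu.symm
    rw [two_div_add_div_rpow_eq, huR]
    exact subcritical_exponent hd1 hr (Nat.le_ceil _) hRr

end Subcritical

section HittingAsymptotics

open Filter Topology Asymptotics

variable {α : Type*} {l : Filter α} {g : ℕ} {q : ℝ}

theorem hitProb_mem_unitInterval (g : ℕ) (hq : q ∈ unitInterval) : hitProb g q ∈ unitInterval :=
  Set.Icc.mem_iff_one_sub_mem.1
    (pow_mem (S := unitInterval.submonoid) (Set.Icc.mem_iff_one_sub_mem.1 hq) g)

theorem one_sub_hitProb_le_exp (g : ℕ) (hq : q ∈ unitInterval) :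
    1 - hitProb g q ≤ Real.exp (-(g * q)) := by
  rw [hitProb, sub_sub_cancel, ← mul_neg, Real.exp_nat_mul]
  exact pow_le_pow_left₀ (sub_nonneg.2 hq.2) (Real.one_sub_le_exp_neg q) g

theorem half_min_le_hitProb (g : ℕ) (hq : q ∈ unitInterval) :
    min (g * q) 1 / 2 ≤ hitProb g q := by
  have hy : 0 ≤ g * q := mul_nonneg g.cast_nonneg hq.1
  have hexp : Real.exp (-(g * q)) ≤ 1 / (1 + g * q) := by
    rw [Real.exp_neg, ← one_div]
    exact one_div_le_one_div_of_le (by linarith) (by linarith [Real.add_one_le_exp (g * q)])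
  have hmin : min (g * q) 1 / 2 ≤ 1 - 1 / (1 + g * q) := by
    rw [one_sub_div (by linarith), add_sub_cancel_left, div_le_div_iff₀ two_pos (by linarith)]
    cases min_cases (g * q) 1 <;> nlinarith
  linarith [one_sub_hitProb_le_exp g hq]

theorem isBigO_hitProb {f q : α → ℝ} {g : α → ℕ} (hq : ∀ x, q x ∈ unitInterval)
    (hfq : f =O[l] fun x => g x * q x) (hf : f =O[l] fun _ => (1 : ℝ)) :
    f =O[l] fun x => hitProb (g x) (q x) := by
  obtain ⟨C₁, hC₁, h₁⟩ := hfq.exists_pos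
  obtain ⟨C₂, h₂⟩ := hf.bound
  refine IsBigO.of_bound (2 * max C₁ C₂) ?_
  filter_upwards [h₁.bound, h₂] with x h₁ h₂
  have hy : 0 ≤ g x * q x := mul_nonneg (g x).cast_nonneg (hq x).1
  rw [Real.norm_of_nonneg hy] at h₁
  rw [norm_one] at h₂
  rw [Real.norm_of_nonneg (hitProb_mem_unitInterval _ (hq x)).1]
  calc ‖f x‖ ≤ max C₁ C₂ * min (g x * q x) 1 := by
        rw [mul_min_of_nonneg _ _ (by positivity)]
        exact le_min (h₁.trans (by gcongr; exact le_max_left ..))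
          (h₂.trans (by gcongr; exact le_max_right ..))
    _ ≤ 2 * max C₁ C₂ * hitProb (g x) (q x) := by
        rw [mul_comm 2, mul_assoc]
        gcongr
        linarith [half_min_le_hitProb (g x) (hq x)]

theorem tendsto_pow_mul_one_sub_hitProb_pow {q : ℕ → ℝ} {g : ℕ → ℕ} {ε : ℝ} (hε : 0 < ε)
    (hq : ∀ n, q n ∈ unitInterval)
    (hgq : (fun n : ℕ => (n : ℝ) ^ ε) =O[atTop] fun n => g n * q n) (d m : ℕ) :
    Tendsto (fun n : ℕ => (n : ℝ) ^ d * (1 - hitProb (g n) (q n) ^ m)) atTop (𝓝 0) := by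
  obtain ⟨C, hC, hbound⟩ := hgq.exists_pos
  have hlim : Tendsto (fun n : ℕ => m * (((n : ℝ) ^ ε) ^ (d / ε) * Real.exp (-C⁻¹ * (n : ℝ) ^ ε)))
      atTop (𝓝 0) := by
    simpa using ((tendsto_rpow_mul_exp_neg_mul_atTop_nhds_zero (d / ε) C⁻¹ (inv_pos.2 hC)).comp
      ((tendsto_rpow_atTop hε).comp tendsto_natCast_atTop_atTop)).const_mul (m : ℝ)
  refine squeeze_zero' (.of_forall fun n => ?_) ?_ hlim
  · have hhit := hitProb_mem_unitInterval (g n) (hq n)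
    exact mul_nonneg (by positivity) (sub_nonneg.2 (pow_le_one₀ hhit.1 hhit.2))
  filter_upwards [hbound.bound] with n hn
  have hhit := hitProb_mem_unitInterval (g n) (hq n)
  rw [Real.norm_of_nonneg (by positivity),
    Real.norm_of_nonneg (mul_nonneg (g n).cast_nonneg (hq n).1), ← inv_mul_le_iff₀ hC] at hn
  rw [← Real.rpow_mul n.cast_nonneg, mul_div_cancel₀ _ hε.ne', Real.rpow_natCast]
  calc (n : ℝ) ^ d * (1 - hitProb (g n) (q n) ^ m)
      ≤ n ^ d * (m * (1 - hitProb (g n) (q n))) := by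
        gcongr
        linarith [one_add_mul_sub_le_pow (by linarith [hhit.1] : -1 ≤ hitProb (g n) (q n)) m]
    _ ≤ n ^ d * (m * Real.exp (-C⁻¹ * (n : ℝ) ^ ε)) := by
        gcongr
        exact (one_sub_hitProb_le_exp _ (hq n)).trans (Real.exp_le_exp.2 (by linarith))
    _ = m * (n ^ d * Real.exp (-C⁻¹ * (n : ℝ) ^ ε)) := mul_left_comm ..

end HittingAsymptotics

section SupercriticalDensity

open Filter Topology Asymptotics

variable {d i θ s k : ℕ} {b : ℝ}

theorem isBigO_natCast_div {m : ℕ} (hm : 0 < m) :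
    (fun n : ℕ => (n : ℝ)) =O[atTop] fun n => ((n / m : ℕ) : ℝ) := by
  refine IsBigO.of_bound (2 * m) ?_
  filter_upwards [eventually_ge_atTop m] with n hn
  rw [Real.norm_natCast, Real.norm_natCast]
  have hlt : n < m * (n / m + 1) := Nat.lt_mul_div_succ n hm
  have hle : m * 1 ≤ m * (n / m) := Nat.mul_le_mul_left m (Nat.div_pos hn hm)
  exact_mod_cast (by linarith : n ≤ 2 * m * (n / m))

theorem isBigO_natCast_rpow_rpow {a c : ℝ} (h : a ≤ c) :
    (fun n : ℕ => (n : ℝ) ^ a) =O[atTop] fun n : ℕ => (n : ℝ) ^ c := by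
  refine IsBigO.of_bound' ?_
  filter_upwards [eventually_ge_atTop 1] with n hn
  rw [Real.norm_of_nonneg (by positivity), Real.norm_of_nonneg (by positivity)]
  exact Real.rpow_le_rpow_of_exponent_le (mod_cast hn) h

theorem isBigO_hitProb_density {g : ℕ → ℕ}
    (hg : (fun n : ℕ => (n : ℝ)) =O[atTop] fun n => (g n : ℝ)) (hb : 0 ≤ b) :
    (fun n : ℕ => (n : ℝ) ^ (-b)) =O[atTop] fun n => hitProb (g n) (density b n) := by
  refine isBigO_hitProb (fun n => (density b n).2) ?_ ?_
  · refine (hg.mul (isBigO_refl (fun n => (density b n : ℝ)) atTop)).congr' ?_ .rfl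
    filter_upwards [eventually_gt_atTop 0] with n hn using natCast_mul_density hb hn
  · simpa using isBigO_natCast_rpow_rpow (neg_nonpos.2 hb)

theorem isBigO_natCast_rpow_mul_pow {g : ℕ → ℕ} {t : ℕ → ℝ}
    (hg : (fun n : ℕ => (n : ℝ)) =O[atTop] fun n => (g n : ℝ))
    (ht : (fun n : ℕ => (n : ℝ) ^ (-b)) =O[atTop] t) (m : ℕ) :
    (fun n : ℕ => (n : ℝ) ^ (1 - b * m)) =O[atTop] fun n => g n * t n ^ m := by
  refine (hg.mul (ht.pow m)).congr' ?_ .rfl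
  filter_upwards [eventually_gt_atTop 0] with n hn
  have hn' : (0 : ℝ) < n := mod_cast hn
  rw [sub_eq_add_neg, Real.rpow_add hn', Real.rpow_one, ← neg_mul, Real.rpow_mul hn'.le,
    Real.rpow_natCast]

theorem linesProb_mem_unitInterval (θ g s k : ℕ) {p : ℝ} (hp : p ∈ unitInterval) :
    linesProb θ g s k p ∈ unitInterval := by
  have hpow {x : ℝ} (m : ℕ) (hx : x ∈ unitInterval) : x ^ m ∈ unitInterval :=
    pow_mem (S := unitInterval.submonoid) hx m
  have hlines (m : ℕ) := hitProb_mem_unitInterval g (hpow m (hitProb_mem_unitInterval g hp))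
  exact unitInterval.mul_mem (hpow _ (hlines _)) (hpow _ (hlines _))

theorem isBigO_linesProb {g : ℕ → ℕ} (θ : ℕ)
    (hg : (fun n : ℕ => (n : ℝ)) =O[atTop] fun n => (g n : ℝ)) (hstrong : 1 ≤ b * s)
    (hweak : b * (s - k : ℕ) ≤ 1) :
    (fun n : ℕ => (n : ℝ) ^ (k * (1 - b * s))) =O[atTop]
      fun n => linesProb θ (g n) s k (density b n) := by
  have hb : 0 < b := pos_of_mul_pos_left (hstrong.trans_lt' one_pos) s.cast_nonneg
  have ht := isBigO_hitProb_density hg hb.le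
  have htm (m n : ℕ) : hitProb (g n) (density b n) ^ m ∈ unitInterval :=
    pow_mem (S := unitInterval.submonoid) (hitProb_mem_unitInterval (g n) (density b n).2) m
  have hweak_line : (fun _ => (1 : ℝ)) =O[atTop]
      fun n => hitProb (g n) (hitProb (g n) (density b n) ^ (s - k)) := by
    refine isBigO_hitProb (htm _) ?_ (isBigO_refl ..)
    refine IsBigO.trans ?_ (isBigO_natCast_rpow_mul_pow hg ht (s - k))
    simpa using isBigO_natCast_rpow_rpow (sub_nonneg.2 hweak)
  have hstrong_line : (fun n : ℕ => (n : ℝ) ^ (1 - b * s)) =O[atTop]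
      fun n => hitProb (g n) (hitProb (g n) (density b n) ^ s) := by
    refine isBigO_hitProb (htm _) (isBigO_natCast_rpow_mul_pow hg ht s) ?_
    simpa using isBigO_natCast_rpow_rpow (sub_nonpos.2 hstrong)
  refine ((hweak_line.pow θ).mul (hstrong_line.pow k)).congr_left fun n => ?_
  rw [one_pow, one_mul, mul_comm (k : ℝ), Real.rpow_mul_natCast n.cast_nonneg]

theorem tendsto_probSubtorusOpen_density_one (hid : i ≤ d) (hd : 3 ≤ d)
    (hθs : θ ≤ 2 * s) (hs : s ≤ θ) (hk : k ≤ θ) (hstrong : 1 ≤ b * s)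
    (hweak : b * (s - k : ℕ) ≤ 1) (hplane : 2 * k * (b * s - 1) < 1) :
    Tendsto (fun n => probSubtorusOpen n d i θ (density b n)) atTop (𝓝 1) := by
  have hθ : 0 < θ := Nat.pos_of_ne_zero fun hθ => by
    rw [Nat.le_zero.1 (hs.trans_eq hθ)] at hstrong
    norm_num at hstrong
  let g : ℕ → ℕ := fun n => n / (3 * θ)
  let Q : ℕ → ℝ := fun n => linesProb θ (g n) s k (density b n) ^ 2
  have hg : (fun n : ℕ => (n : ℝ)) =O[atTop] fun n => (g n : ℝ) := isBigO_natCast_div (by omega)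
  have hQ (n : ℕ) : Q n ∈ unitInterval :=
    pow_mem (S := unitInterval.submonoid) (linesProb_mem_unitInterval _ _ _ _ (density b n).2) 2
  have hgQ : (fun n : ℕ => (n : ℝ) ^ (1 - 2 * k * (b * s - 1))) =O[atTop]
      fun n => g n * Q n := by
    refine (hg.mul ((isBigO_linesProb θ hg hstrong hweak).pow 2)).congr' ?_ .rfl
    filter_upwards [eventually_gt_atTop 0] with n hn
    rw [← Real.rpow_mul_natCast n.cast_nonneg, sub_eq_add_neg 1 (2 * k * (b * s - 1)),
      Real.rpow_add (mod_cast hn), Real.rpow_one]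
    congr 2
    push_cast
    ring
  have hlim : Tendsto (fun n : ℕ => 1 - (n : ℝ) ^ d * (1 - hitProb (g n) (Q n) ^ θ)) atTop
      (𝓝 1) := by
    simpa using (tendsto_pow_mul_one_sub_hitProb_pow (sub_pos.2 hplane) hQ hgQ d θ).const_sub 1
  refine tendsto_of_tendsto_of_tendsto_of_le_of_le' hlim tendsto_const_nhds ?_
    (.of_forall fun n => measureReal_le_one)
  filter_upwards [eventually_ge_atTop (3 * θ)] with n hn
  exact le_probSubtorusOpen hid hd (Nat.div_pos hn (by omega)) hθs hs hk (Nat.mul_div_le ..)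
    (by omega) _

theorem supercritical_exponent {r s k b : ℝ} (hr : 16 ≤ r) (hs : r ^ 2 ≤ 2 * s)
    (hs' : 2 * s ≤ r ^ 2 + 1) (hk : r ≤ k + 1) (hk' : k ≤ r)
    (hb : b = 2 / r ^ 2 + 1 / 16 / r ^ 3) :
    1 ≤ b * s ∧ b * (s - k) ≤ 1 ∧ 2 * k * (b * s - 1) < 1 := by
  have hr0 : 0 < r := by linarith
  have hb0 : 0 < b := by rw [hb]; positivity
  have hbs : b * s ≤ 1 + 1 / (8 * r) := by
    calc b * s ≤ b * ((r ^ 2 + 1) / 2) := by gcongr; linarith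
      _ ≤ 1 + 1 / (8 * r) := by
        rw [hb]
        field_simp
        nlinarith
  have hbk : 1 / (8 * r) ≤ b * k := by
    calc 1 / (8 * r) ≤ 2 / r ^ 2 * (r - 1) := by
          field_simp
          linarith
      _ ≤ b * k := by
        gcongr
        · linarith
        · rw [hb]; exact le_add_of_nonneg_right (by positivity)
        · linarith
  have hstrong : 1 ≤ b * s := by
    calc 1 = 2 / r ^ 2 * (r ^ 2 / 2) := by field_simp
      _ ≤ b * s := by
        gcongr
        · rw [hb]; exact le_add_of_nonneg_right (by positivity)
        · linarith
  refine ⟨hstrong, by linarith, ?_⟩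
  calc 2 * k * (b * s - 1) ≤ 2 * r * (1 / (8 * r)) :=
        mul_le_mul (by linarith) (by linarith) (by linarith) (by positivity)
    _ < 1 := by field_simp; norm_num

theorem tendsto_probSubtorusOpen_one (hid : i ≤ d) (hd : 3 ≤ d) (hθ : 256 ≤ θ) :
    Tendsto (fun n => probSubtorusOpen n d i θ
      (density (2 / (θ : ℝ) + 1 / 16 / (θ : ℝ) ^ (3 / 2 : ℝ)) n)) atTop (𝓝 1) := by
  obtain ⟨s, hθs, hsθ⟩ : ∃ s, θ ≤ 2 * s ∧ 2 * s ≤ θ + 1 := ⟨(θ + 1) / 2, by omega, by omega⟩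
  have hkθ : θ.sqrt * θ.sqrt ≤ θ := Nat.sqrt_le θ
  have hks : θ.sqrt ≤ s := by nlinarith
  have hr : 16 ≤ √(θ : ℝ) := Real.le_sqrt_of_sq_le (by norm_num; exact_mod_cast hθ)
  -- Strong lines are just slightly too rare to occur in a given plane, weak lines are abundant.
  obtain ⟨hstrong, hweak, hplane⟩ := supercritical_exponent (s := s) (k := θ.sqrt) hr
    (by rw [Real.sq_sqrt θ.cast_nonneg]; exact_mod_cast hθs)
    (by rw [Real.sq_sqrt θ.cast_nonneg]; exact_mod_cast hsθ)
    Real.real_sqrt_le_nat_sqrt_succ Real.nat_sqrt_le_real_sqrt (two_div_add_div_rpow_eq _ θ)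
  exact tendsto_probSubtorusOpen_density_one hid hd hθs (by omega)
    (Nat.sqrt_le_self θ) hstrong (by rwa [Nat.cast_sub hks]) hplane

end SupercriticalDensity

end HammingBootstrap

theorem theorem2p5 (i d : ℕ) (hi : 2 ≤ i) (hid : i ≤ d) (hd : 3 ≤ d) :
    ∃ c C : ℝ, 0 < c ∧ 0 < C ∧ ∃ θ₀ : ℕ, ∀ θ : ℕ, θ₀ ≤ θ → ∃ N : ℕ, ∀ n : ℕ, N ≤ n →
      (∃! p : unitInterval, HammingBootstrap.IsThreshold n d i θ p) ∧
      ∀ p : unitInterval, HammingBootstrap.IsThreshold n d i θ p →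
        (n : ℝ) ^ (-1 - 2 / (θ : ℝ) - C / (θ : ℝ) ^ (3 / 2 : ℝ)) ≤ (p : ℝ) ∧
        (p : ℝ) ≤ (n : ℝ) ^ (-1 - 2 / (θ : ℝ) - c / (θ : ℝ) ^ (3 / 2 : ℝ)) := by
  refine ⟨1 / 16, 100 * (d : ℝ) ^ 2, by norm_num, by positivity, max 256 (64 * d ^ 4),
    fun θ hθ => ?_⟩
  obtain ⟨hθ256, hθd⟩ := max_le_iff.1 hθ
  have hsub := HammingBootstrap.tendsto_probSubtorusOpen_zero hi (by omega : 2 ≤ d) hθd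
  have hsup := HammingBootstrap.tendsto_probSubtorusOpen_one hid hd hθ256
  obtain ⟨N, hN⟩ := Filter.eventually_atTop.1 <|
    (hsub.eventually_lt_const one_half_pos).and <|
      (hsup.eventually_const_lt one_half_lt_one).and (Filter.eventually_gt_atTop 0)
  refine ⟨N, fun n hn => ?_⟩
  obtain ⟨hlow, hhigh, hn0⟩ := hN n hn
  have hθ0 : 0 < θ := by omega
  have hmono := HammingBootstrap.probSubtorusOpen_strictMono hid hn0 hθ0
  refine ⟨HammingBootstrap.existsUnique_isThreshold hid hn0 hθ0, fun p hp => ?_⟩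
  rw [sub_sub, sub_sub, ← HammingBootstrap.coe_density (by positivity) hn0,
    ← HammingBootstrap.coe_density (by positivity) hn0]
  rw [← hp] at hlow hhigh
  exact ⟨(hmono.lt_iff_lt.1 hlow).le, (hmono.lt_iff_lt.1 hhigh).le⟩
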